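/- Notation. Let $N\in\mathbb N=\{1,2,\dots\}$ and $\sigma>0$. A configuration $\xi=\sum_{j=1}^N\delta_{a_j}$, $a_1\le\cdots\le a_N$, is a finite multiset of reals; $\xi_n=\sum_{j=1}^n\delta_{a_j}$, and products over $a\in\xi_n$ count multiplicities. Powers and square roots of complex numbers are principal. For $t\in\mathbb R\setminus\{0\}$ and $x,y\in\mathbb C$ put $$p(t,y|x)=\frac{1}{\sqrt{2\pi|t|}}\,e^{-(x-y)^2/2t},$$ and for $\nu>-1$ $$p^{(\nu)}(t,y|x)=\frac1{2|t|}\Big(\frac yx\Big)^{\nu/2}e^{-(x+y)/2t}\,I_\nu\Big(\frac{\sqrt{xy}}t\Big)\ (x\ne0),\qquad p^{(\nu)}(t,y|0)=\frac{y^\nu}{(2|t|)^{\nu+1}\Gamma(\nu+1)}e^{-y/2t},$$ where $I_\nu(z)=\sum_{n\ge0}\frac{(z/2)^{2n+\nu}}{\Gamma(n+1)\Gamma(n+1+\nu)}$. For $t>0$ and $0\le n\le N-1$ let $$\phi^{(+)}_n(t,x;\xi)=\frac1{2\pi i}\oint\frac{p(t,x|s)}{\prod_{a\in\xi_{n+1}}(s-a)}ds,\qquad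 \phi^{(-)}_n(t,x;\xi)=\int_{\mathbb R}p(-t,is|x)\prod_{a\in\xi_n}(is-a)\,ds,$$ $$\phi^{(\nu,+)}_n(t,x;\xi)=\frac1{2\pi i}\oint\frac{p^{(\nu)}(t,x|s)}{\prod_{a\in\xi_{n+1}}(s-a)}ds,\qquad \phi^{(\nu,-)}_n(t,x;\xi)=\int_{-\infty}^0p^{(\nu)}(-t,s|x)\prod_{a\in\xi_n}(s-a)\,ds,$$ where the contour is a circle centred at the origin that encircles the points of $\xi_{n+1}$ once in the positive direction. The correlation kernels of the noncolliding Brownian motion and of the noncolliding squared Bessel process (BESQ) of index $\nu$ started from $\xi$ are $$\mathbb K^\xi(s,x;t,y)=\sum_{n=0}^{N-1}\phi^{(+)}_n(s,x;\xi)\phi^{(-)}_n(t,y;\xi)-\mathbf 1(s>t)\,p(s-t,x|y),$$ $$\mathbb K^\xi_\nu(s,x;t,y)=\sum_{n=0}^{N-1}\phi^{(\nu,+)}_n(s,x;\xi)\phi^{(\nu,-)}_n(t,y;\xi)-\mathbf 1(s>t)\,p^{(\nu)}(s-t,x|y).$$ With $h_N(\mathbf x)=\prod_{1\le j<k\le N}(x_k-x_j)$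 and $\Xi=\sum_{j=1}^N\delta_{x_j}$, the GUE and chiral GUE expectations are $$\mathbf E_{N,\sigma^2}[F(\Xi)]=\int_{x_1<\cdots<x_N}F(\Xi)\,\frac{\sigma^{-N^2}}{(2\pi)^{N/2}\prod_{j=1}^N\Gamma(j)}\,e^{-|\mathbf x|^2/2\sigma^2}\,h_N(\mathbf x)^2\,d\mathbf x,$$ $$\mathbf E^{(\nu)}_{N,\sigma^2}[F(\Xi)]=\int_{0\le x_1<\cdots<x_N}F(\Xi)\,\frac{\sigma^{-2N(N+\nu)}}{2^{N(N+\nu)}\prod_{j=1}^N\Gamma(j)\Gamma(j+\nu)}\prod_{j=1}^N\big(x_j^\nu e^{-x_j/2\sigma^2}\big)\,h_N(\mathbf x)^2\,d\mathbf x.$$ Statement. Let $M\in\mathbb N$, $0<t_1<\cdots<t_M<\infty$ and $N_m\in\{1,\dots,N\}$ for $1\le m\le M$. For all real points $x^{(m)}_j$, $1\le j\le N_m$, $1\le m\le M$, $$\mathbf E_{N,\sigma^2}\Big[\det_{\substack{1\le j\le N_m,\,1\le k\le N_n\\1\le m,n\le M}}\big[\mathbb K^{\Xi}(t_m,x^{(m)}_j;t_n,x^{(n)}_k)\big]\Big]=\det_{\substack{1\le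 j\le N_m,\,1\le k\le N_n\\1\le m,n\le M}}\big[\mathbb K^{N\delta_0}(t_m+\sigma^2,x^{(m)}_j;t_n+\sigma^2,x^{(n)}_k)\big],$$ and for every $\nu>-1$ and all points $x^{(m)}_j\ge0$ (with $x^{(m)}_j>0$ if $\nu<0$), $$\mathbf E^{(\nu)}_{N,\sigma^2}\Big[\det_{\substack{1\le j\le N_m,\,1\le k\le N_n\\1\le m,n\le M}}\big[\mathbb K^{\Xi}_\nu(t_m,x^{(m)}_j;t_n,x^{(n)}_k)\big]\Big]=\det_{\substack{1\le j\le N_m,\,1\le k\le N_n\\1\le m,n\le M}}\big[\mathbb K^{N\delta_0}_\nu(t_m+\sigma^2,x^{(m)}_j;t_n+\sigma^2,x^{(n)}_k)\big];$$ the expectations on the left exist, i.e. the integrals defining them converge absolutely. In particular, for $1\le L\le N$, $t>0$ and points $x_1,\dots,x_L$ as above, $$\mathbf E_{N,\sigma^2}\Big[\det_{1\le j,k\le L}[\mathbb K^{\Xi}(t,x_j;t,x_k)]\Big]=\det_{1\le j,k\le L}[\mathbb K^{N\delta_0}(t+\sigma^2,x_j;t+\sigma^2,x_k)],$$ $$\mathbf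 E^{(\nu)}_{N,\sigma^2}\Big[\det_{1\le j,k\le L}[\mathbb K^{\Xi}_\nu(t,x_j;t,x_k)]\Big]=\det_{1\le j,k\le L}[\mathbb K^{N\delta_0}_\nu(t+\sigma^2,x_j;t+\sigma^2,x_k)].$$ -/

import Mathlib

open MeasureTheory
open scoped Real

noncomputable section

/-! ### Configurations

A configuration `ξ = ∑ⱼ δ_{xⱼ}` of finitely many points of the real line, multiple points being
allowed, is a multiset of reals; its cardinality is the number `N` of particles. -/

/-- The configuration `∑ⱼ δ_{xⱼ}`. -/
def configOf {N : ℕ} (x : Fin N → ℝ) : Multiset ℝ :=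
  Finset.univ.val.map x

/-- The configuration `N δ₀`. -/
def configZero (N : ℕ) : Multiset ℝ :=
  Multiset.replicate N 0

/-- For `ξ = ∑ⱼ δ_{aⱼ}` with `a₁ ≤ a₂ ≤ ⋯ ≤ a_N`, the configuration
`ξₙ = ∑_{j ≤ n} δ_{aⱼ}` of the `n` smallest points. -/
def configTake (ξ : Multiset ℝ) (n : ℕ) : Multiset ℝ :=
  ((ξ.sort (· ≤ ·)).take n : List ℝ)

/-- The polynomial `∏_{a ∈ ξ} (s - a)`, points being counted with their multiplicity. -/
def configProd (ξ : Multiset ℝ) (s : ℂ) : ℂ :=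
  (ξ.map fun a : ℝ => s - (a : ℂ)).prod

/-- The integral `(2πi)⁻¹ ∮ f(s) ds` along a closed contour encircling all the points of `ξ` once
in the positive direction: the circle about the origin of radius `1 + ∑_{a ∈ ξ} |a|`. -/
def contourAround (ξ : Multiset ℝ) (f : ℂ → ℂ) : ℂ :=
  (2 * π * Complex.I)⁻¹ * ∮ s in C(0, 1 + (ξ.map fun a : ℝ => |a|).sum), f s

/-! ### Noncolliding Brownian motion -/

/-- The Gaussian kernel `p(t, y | x)` for `t ≠ 0` of either sign and complex `x`, `y`.
(The value at `t = 0`, where the kernel is a delta function, is never used.) -/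
def bmP (t : ℝ) (y x : ℂ) : ℂ :=
  1 / (√(2 * π * |t|) : ℝ) * Complex.exp (-(x - y) ^ 2 / (2 * t))

/-- `φₙ⁺(t, x; ξ) = (2πi)⁻¹ ∮ p(t, x | s) / ∏_{a ∈ ξₙ₊₁} (s - a) ds`, for `t > 0`. -/
def bmPhiPlus (n : ℕ) (t : ℝ) (x : ℂ) (ξ : Multiset ℝ) : ℂ :=
  contourAround (configTake ξ (n + 1)) fun s =>
    bmP t x s * (1 / configProd (configTake ξ (n + 1)) s)

/-- `φₙ⁻(t, x; ξ) = ∫_ℝ p(-t, i s | x) ∏_{a ∈ ξₙ} (i s - a) ds`, for `t > 0`. -/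
def bmPhiMinus (n : ℕ) (t : ℝ) (x : ℂ) (ξ : Multiset ℝ) : ℂ :=
  ∫ s : ℝ, bmP (-t) (Complex.I * s) x * configProd (configTake ξ n) (Complex.I * s)

/-- The correlation kernel `K^ξ(s, x; t, y)` of the noncolliding Brownian motion started
from `ξ`. -/
def bmKernel (ξ : Multiset ℝ) (s x t y : ℝ) : ℂ :=
  (∑ n ∈ Finset.range ξ.card, bmPhiPlus n s x ξ * bmPhiMinus n t y ξ)
    - if t < s then bmP (s - t) x y else 0

/-! ### Noncolliding squared Bessel process -/

/-- The modified Bessel function of the first kind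
`I_ν(z) = ∑ₙ (z / 2)^(2n + ν) / (Γ(n + 1) Γ(n + 1 + ν))`, with principal powers. -/
def besselI (ν : ℝ) (z : ℂ) : ℂ :=
  ∑' n : ℕ, 1 / ((Real.Gamma (n + 1) * Real.Gamma (n + 1 + ν) : ℝ) : ℂ)
    * (z / 2) ^ ((2 * n + ν : ℝ) : ℂ)

/-- The kernel `p^{(ν)}(t, y | x)` for `t ≠ 0` of either sign and complex `x`, `y`, with principal
powers and square root. (The value at `t = 0`, where the kernel is a delta function, is never
used.) -/
def besqP (ν t : ℝ) (y x : ℂ) : ℂ :=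
  if x = 0 then
    y ^ (ν : ℂ) / (((2 * |t|) ^ (ν + 1) * Real.Gamma (ν + 1) : ℝ) : ℂ) * Complex.exp (-y / (2 * t))
  else
    1 / (2 * |t| : ℝ) * (y / x) ^ ((ν / 2 : ℝ) : ℂ) * Complex.exp (-(x + y) / (2 * t))
      * besselI ν ((x * y) ^ (1 / 2 : ℂ) / t)

/-- `φₙ^{(ν,+)}(t, x; ξ) = (2πi)⁻¹ ∮ p^{(ν)}(t, x | s) / ∏_{a ∈ ξₙ₊₁} (s - a) ds`, for `t > 0`. -/
def besqPhiPlus (ν : ℝ) (n : ℕ) (t : ℝ) (x : ℂ) (ξ : Multiset ℝ) : ℂ :=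
  contourAround (configTake ξ (n + 1)) fun s =>
    besqP ν t x s * (1 / configProd (configTake ξ (n + 1)) s)

/-- `φₙ^{(ν,-)}(t, x; ξ) = ∫_{-∞}^0 p^{(ν)}(-t, s | x) ∏_{a ∈ ξₙ} (s - a) ds`, for `t > 0`. -/
def besqPhiMinus (ν : ℝ) (n : ℕ) (t : ℝ) (x : ℂ) (ξ : Multiset ℝ) : ℂ :=
  ∫ s in Set.Iic (0 : ℝ), besqP ν (-t) s x * configProd (configTake ξ n) s

/-- The correlation kernel `K_ν^ξ(s, x; t, y)` of the noncolliding squared Bessel process of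
index `ν` started from `ξ`. -/
def besqKernel (ν : ℝ) (ξ : Multiset ℝ) (s x t y : ℝ) : ℂ :=
  (∑ n ∈ Finset.range ξ.card, besqPhiPlus ν n s x ξ * besqPhiMinus ν n t y ξ)
    - if t < s then besqP ν (s - t) x y else 0

/-! ### The random initial configurations -/

/-- The product of differences `h_N(x) = ∏_{j < k} (x_k - x_j)`. -/
def hProd {N : ℕ} (x : Fin N → ℝ) : ℝ :=
  ∏ j, ∏ k ∈ Finset.Ioi j, (x k - x j)

/-- The chamber `x₁ < x₂ < ⋯ < x_N`. -/
def chamberA (N : ℕ) : Set (Fin N → ℝ) :=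
  {x | StrictMono x}

/-- The chamber `0 ≤ x₁ < x₂ < ⋯ < x_N`. -/
def chamberPlus (N : ℕ) : Set (Fin N → ℝ) :=
  {x | (∀ j, 0 ≤ x j) ∧ StrictMono x}

/-- The density `μ_{N,σ²}` of the eigenvalues of the GUE with variance `σ²`, with respect to
Lebesgue measure on the chamber `x₁ < ⋯ < x_N`. -/
def gueDensity (N : ℕ) (σ : ℝ) (x : Fin N → ℝ) : ℝ :=
  (σ ^ N ^ 2)⁻¹ / ((2 * π) ^ (N / 2 : ℝ) * ∏ j ∈ Finset.Icc 1 N, Real.Gamma j)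
    * Real.exp (-(∑ j, x j ^ 2) / (2 * σ ^ 2)) * hProd x ^ 2

/-- The density `μ^{(ν)}_{N,σ²}` of the squared singular values of the chiral GUE with index `ν`
and variance `σ²`, with respect to Lebesgue measure on the chamber `0 ≤ x₁ < ⋯ < x_N`. -/
def chgueDensity (N : ℕ) (ν σ : ℝ) (x : Fin N → ℝ) : ℝ :=
  σ ^ (-(2 * N * (N + ν)))
      / (2 ^ (N * (N + ν)) * ∏ j ∈ Finset.Icc 1 N, (Real.Gamma j * Real.Gamma (j + ν)))
    * (∏ j, (x j ^ ν * Real.exp (-x j / (2 * σ ^ 2)))) * hProd x ^ 2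

/-- `F(Ξ)` has a finite expectation when `Ξ` has the GUE density `μ_{N,σ²}`. -/
def GueIntegrable (N : ℕ) (σ : ℝ) (F : Multiset ℝ → ℂ) : Prop :=
  IntegrableOn (fun x : Fin N → ℝ => F (configOf x) * (gueDensity N σ x : ℂ)) (chamberA N)

/-- The expectation `E_{N,σ²}[F(Ξ)]`. -/
def gueExpect (N : ℕ) (σ : ℝ) (F : Multiset ℝ → ℂ) : ℂ :=
  ∫ x in chamberA N, F (configOf x) * (gueDensity N σ x : ℂ)

/-- `F(Ξ)` has a finite expectation when `Ξ` has the density `μ^{(ν)}_{N,σ²}`. -/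
def ChgueIntegrable (N : ℕ) (ν σ : ℝ) (F : Multiset ℝ → ℂ) : Prop :=
  IntegrableOn (fun x : Fin N → ℝ => F (configOf x) * (chgueDensity N ν σ x : ℂ)) (chamberPlus N)

/-- The expectation `E^{(ν)}_{N,σ²}[F(Ξ)]`. -/
def chgueExpect (N : ℕ) (ν σ : ℝ) (F : Multiset ℝ → ℂ) : ℂ :=
  ∫ x in chamberPlus N, F (configOf x) * (chgueDensity N ν σ x : ℂ)

/-! ### Multitime determinants -/

/-- The determinant of the block matrix with entries
`K(t_m, x^{(m)}_j; t_n, x^{(n)}_k)`, `1 ≤ j ≤ N_m`, `1 ≤ k ≤ N_n`, `1 ≤ m, n ≤ M`. -/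
def multitimeDet {M : ℕ} (L : Fin M → ℕ) (K : ℝ → ℝ → ℝ → ℝ → ℂ) (t : Fin M → ℝ)
    (x : (m : Fin M) → Fin (L m) → ℝ) : ℂ :=
  (Matrix.of fun p q : (m : Fin M) × Fin (L m) =>
    K (t p.1) (x p.1 p.2) (t q.1) (x q.1 q.2)).det

end

/-!
Both processes are treated by one and the same argument. For an entire function `f` and a
configuration `ξ`, the contour integrals of `f / ∏_{a ∈ ξ_{n+1}} (s - a)` are the divided
differences of `f`, so they are the coefficients of Newton interpolation at the points of `ξ`
(`newton_interpolation`), while the second factors of the kernel are linear functionals of the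
Newton polynomials `∏_{a ∈ ξ_n} (s - a)`, which are monic of degree `n`. By elimination in block
matrices, `det [K^ξ(p, q)] · h_N(a)` is therefore, up to sign, the bordered Vandermonde determinant
`det [[a_k ^ m, b_q(m)], [f_p(a_k), P(p, q)]]`, where `b_q(m)` is the value of the functional on the
monomial of degree `m` and `P` is the correction term of the kernel (`det_kernel_mul_hProd`). The
ordering of the points no longer matters in this form.

The density of the initial configuration contains `h_N(a) ^ 2`. One factor is spent on the kernel,
the other one is expanded over permutations and turns the integral over the chamber into one over
the whole space, where the bordered determinant is integrated column by column, as in Andréief's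
identity (`integral_prod_mul_borderedDet`). The result is the determinant of a block matrix built
from the moments `G_{mk} = ∫ a ^ (m + k) w(a) da` of the weight, from
`Q_{pk} = ∫ f_p(a) a ^ k w(a) da`, from `b_q(m)` and from `P`. If `G = D T`, `Q = C T` and `b = D B` with triangular `D` and `T`, it
equals `det D · det T · det (C B - P)` up to the same sign (`expect_det`).

These factorizations are forms of the Chapman–Kolmogorov equation. The functionals `b_q` evolve
monomials backwards in time, so changing `t` to `t + σ²` acts by a triangular matrix `D`. The weight
is the transition density from the origin over the time `σ²`, so integrating `f_p` against it
amounts to changing `t` to `t + σ²` as well, up to the triangular matrix `T` that expresses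
`a ^ k w(a)`. The remaining factors `C` and `B` are precisely the functions that build the kernel
started from `N δ₀`. For Brownian motion all of this is read off from the generating series
`exp (μ X + v X² / 2)` of the heat polynomials (`heatSeries`), the identity `G = D T` being Wick's
formula (`wick`); for the squared Bessel process the series is that of the Laguerre polynomials
(`laguerreSeries`), and `G = D T` is the Chu–Vandermonde identity (`exp_mul_kummer`). The product
`det D · det T` is the normalizing constant of the ensemble.

In the Bessel case the integrand of the contour integral is given by principal powers with a branch
cut. It agrees off the cut with an entire function (`besqP_eq_besqEntire`), which is what the
interpolation argument needs.
-/

/-! ### Configurations and Newton interpolation -/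

lemma configProd_zero_config (s : ℂ) : configProd 0 s = 1 := by
  simp [configProd]

lemma configTake_zero (ξ : Multiset ℝ) : configTake ξ 0 = 0 := by
  simp [configTake]

lemma configTake_card (ξ : Multiset ℝ) : configTake ξ ξ.card = ξ := by
  unfold configTake
  rw [List.take_of_length_le (by simp)]
  exact Multiset.sort_eq _ _

lemma configTake_le (ξ : Multiset ℝ) (n : ℕ) : configTake ξ n ≤ ξ := by
  conv_rhs => rw [← Multiset.sort_eq ξ (· ≤ ·)]
  exact Multiset.coe_le.2 (List.take_sublist _ _).subperm

lemma configTake_succ (ξ : Multiset ℝ) {n : ℕ} (hn : n < ξ.card) :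
    ∃ a ∈ ξ, configTake ξ (n + 1) = a ::ₘ configTake ξ n := by
  have hl : n < (ξ.sort (· ≤ ·)).length := by simpa using hn
  refine ⟨(ξ.sort (· ≤ ·))[n], ?_, ?_⟩
  · exact (Multiset.mem_sort _).1 (List.getElem_mem hl)
  · unfold configTake
    rw [List.take_succ_eq_append_getElem hl, ← Multiset.coe_add, add_comm]
    rfl

lemma configProd_cons (a : ℝ) (ξ : Multiset ℝ) (s : ℂ) :
    configProd (a ::ₘ ξ) s = (s - a) * configProd ξ s := by
  simp [configProd]

lemma configProd_eq_zero_iff {ξ : Multiset ℝ} {s : ℂ} :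
    configProd ξ s = 0 ↔ ∃ a ∈ ξ, s = (a : ℂ) := by
  unfold configProd
  rw [Multiset.prod_eq_zero_iff, Multiset.mem_map]
  simp only [sub_eq_zero]

lemma configProd_differentiable (ξ : Multiset ℝ) : Differentiable ℂ (configProd ξ) := by
  induction ξ using Multiset.induction_on with
  | empty =>
    have : configProd 0 = fun _ => (1 : ℂ) := funext configProd_zero_config
    rw [this]; fun_prop
  | cons a ξ ih =>
    have : configProd (a ::ₘ ξ) = fun s => (s - a) * configProd ξ s :=
      funext (configProd_cons a ξ)
    rw [this]; fun_prop

lemma abs_le_sum_abs {ξ : Multiset ℝ} {a : ℝ} (ha : a ∈ ξ) : |a| ≤ (ξ.map fun a : ℝ => |a|).sum :=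
  Multiset.single_le_sum (by simp) _ (Multiset.mem_map_of_mem _ ha)

lemma sum_abs_mono {ξ η : Multiset ℝ} (h : ξ ≤ η) :
    (ξ.map fun a : ℝ => |a|).sum ≤ (η.map fun a : ℝ => |a|).sum := by
  obtain ⟨ζ, rfl⟩ := Multiset.le_iff_exists_add.1 h
  rw [Multiset.map_add, Multiset.sum_add]
  exact le_add_of_nonneg_right (Multiset.sum_nonneg (by simp))

lemma configProd_ne_zero {ξ : Multiset ℝ} {s : ℂ}
    (hs : 1 + (ξ.map fun a : ℝ => |a|).sum ≤ ‖s‖) : configProd ξ s ≠ 0 := by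
  rw [Ne, configProd_eq_zero_iff]
  rintro ⟨a, ha, rfl⟩
  have := abs_le_sum_abs ha
  rw [Complex.norm_real, Real.norm_eq_abs] at hs
  linarith

/-- The contour of a subconfiguration may be replaced by the one of the whole configuration. -/
lemma contourAround_of_le {ξ η : Multiset ℝ} (h : ξ ≤ η) {f : ℂ → ℂ} (hf : Differentiable ℂ f) :
    contourAround ξ (fun s => f s * (1 / configProd ξ s)) =
      contourAround η (fun s => f s * (1 / configProd ξ s)) := by
  unfold contourAround
  congr 1
  have h0 : 0 ≤ (ξ.map fun a : ℝ => |a|).sum := Multiset.sum_nonneg (by simp)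
  have hd : ∀ z : ℂ, 1 + (ξ.map fun a : ℝ => |a|).sum ≤ ‖z‖ →
      DifferentiableAt ℂ (fun s => f s * (1 / configProd ξ s)) z := fun z hz =>
    (hf z).mul ((differentiableAt_const _).div (configProd_differentiable ξ z)
      (configProd_ne_zero hz))
  refine (Complex.circleIntegral_eq_of_differentiable_on_annulus_off_countable (by linarith)
    (by linarith [sum_abs_mono h]) (s := ∅) Set.countable_empty ?_ ?_).symm
  · intro z hz
    refine (hd z ?_).continuousAt.continuousWithinAt
    simpa using hz.2
  · intro z hz
    refine hd z ?_
    simpa using (not_le.1 (by simpa using hz.1.2)).le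

/-- Newton interpolation reproduces the values at the nodes. -/
lemma newton_interpolation (ξ : Multiset ℝ) {f : ℂ → ℂ} (hf : Differentiable ℂ f) {a : ℝ}
    (ha : a ∈ ξ) :
    ∑ n ∈ Finset.range ξ.card,
      contourAround (configTake ξ (n + 1))
        (fun s => f s * (1 / configProd (configTake ξ (n + 1)) s)) *
        configProd (configTake ξ n) a = f a := by
  have h0 : 0 ≤ (ξ.map fun a : ℝ => |a|).sum := Multiset.sum_nonneg (by simp)
  set R : ℝ := 1 + (ξ.map fun a : ℝ => |a|).sum with hR
  have hR0 : 0 ≤ R := by linarith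
  have hne : ∀ s ∈ Metric.sphere (0 : ℂ) R, ∀ n, configProd (configTake ξ n) s ≠ 0 := by
    intro s hs n
    refine configProd_ne_zero ?_
    rw [mem_sphere_zero_iff_norm] at hs
    linarith [sum_abs_mono (configTake_le ξ n)]
  have hsa : ∀ s ∈ Metric.sphere (0 : ℂ) R, s - a ≠ 0 := by
    intro s hs h
    rw [mem_sphere_zero_iff_norm, sub_eq_zero.1 h, Complex.norm_real, Real.norm_eq_abs] at hs
    linarith [abs_le_sum_abs ha]
  -- the telescoping sum behind the interpolation formula
  have tel : ∀ s ∈ Metric.sphere (0 : ℂ) R, ∀ m ≤ ξ.card, ∑ n ∈ Finset.range m,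
      1 / configProd (configTake ξ (n + 1)) s * configProd (configTake ξ n) a =
      (s - a)⁻¹ * (1 - configProd (configTake ξ m) a / configProd (configTake ξ m) s) := by
    intro s hs m
    induction m with
    | zero => simp [configTake_zero, configProd_zero_config]
    | succ m ih =>
      intro hm
      rw [Finset.sum_range_succ, ih (by omega)]
      obtain ⟨b, _, hb⟩ := configTake_succ ξ (n := m) (by omega)
      have h1 := hne s hs m
      have h2 := hne s hs (m + 1)
      have h3 := hsa s hs
      rw [hb, configProd_cons] at h2 ⊢
      have h4 := left_ne_zero_of_mul h2
      rw [configProd_cons]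
      field_simp
      ring
  have hcont : ∀ n, ContinuousOn (fun s => f s * (1 / configProd (configTake ξ n) s))
      (Metric.sphere (0 : ℂ) R) := fun n =>
    hf.continuous.continuousOn.mul (continuousOn_const.div
      (configProd_differentiable _).continuous.continuousOn fun s hs => hne s hs n)
  have key : ∑ n ∈ Finset.range ξ.card,
      contourAround ξ (fun s => f s * (1 / configProd (configTake ξ (n + 1)) s)) *
        configProd (configTake ξ n) a = (2 * π * Complex.I)⁻¹ * ∮ s in C(0, R), (s - a)⁻¹ • f s := by
    unfold contourAround
    simp_rw [mul_assoc, ← Finset.mul_sum]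
    rw [← hR]
    congr 1
    simp_rw [mul_comm (∮ s in C(0, R), _) (configProd _ _), ← circleIntegral.integral_const_mul]
    rw [← circleIntegral.integral_fun_sum]
    · refine circleIntegral.integral_congr hR0 fun s hs => ?_
      have := tel s hs _ le_rfl
      have h0 : configProd ξ a = 0 := configProd_eq_zero_iff.2 ⟨a, ha, rfl⟩
      rw [configTake_card, h0, zero_div, sub_zero, mul_one] at this
      simp only [smul_eq_mul]
      rw [← this, Finset.sum_mul]
      refine Finset.sum_congr rfl fun n _ => by ring
    · intro n _
      exact (continuousOn_const.mul (hcont (n + 1))).circleIntegrable hR0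
  rw [Finset.sum_congr rfl fun n _ => by rw [contourAround_of_le (configTake_le ξ (n + 1)) hf], key,
    Complex.circleIntegral_sub_inv_smul_of_differentiable_on_off_countable Set.countable_empty
      _ hf.continuous.continuousOn fun x _ => hf x, smul_eq_mul, inv_mul_cancel_left₀]
  · simp [Real.pi_ne_zero]
  · rw [mem_ball_zero_iff, Complex.norm_real, Real.norm_eq_abs]
    linarith [abs_le_sum_abs ha]

/-- The Taylor coefficients of an entire function, as contour integrals for `N δ₀`. -/
lemma contourAround_replicate_zero {f : ℂ → ℂ} (hf : Differentiable ℂ f) {c : ℕ → ℂ}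
    (hc : ∀ z, HasSum (fun n => c n * z ^ n) (f z)) (n : ℕ) :
    contourAround (Multiset.replicate (n + 1) 0)
      (fun s => f s * (1 / configProd (Multiset.replicate (n + 1) 0) s)) = c n := by
  have h1 : HasFPowerSeriesAt f (cauchyPowerSeries f 0 1) 0 :=
    ((hf.differentiableOn (s := Metric.closedBall 0 ((1 : NNReal) : ℝ))).hasFPowerSeriesOnBall
      (by norm_num)).hasFPowerSeriesAt
  have h2 : HasFPowerSeriesAt f (FormalMultilinearSeries.ofScalars ℂ c) 0 := by
    rw [hasFPowerSeriesAt_iff]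
    refine Filter.Eventually.of_forall fun z => ?_
    simpa [FormalMultilinearSeries.coeff_ofScalars, mul_comm] using hc z
  have h3 := congrArg (fun p => FormalMultilinearSeries.coeff p n) (h1.eq_formalMultilinearSeries h2)
  simp only [FormalMultilinearSeries.coeff_ofScalars] at h3
  rw [← h3, FormalMultilinearSeries.coeff, Pi.one_def, cauchyPowerSeries_apply]
  unfold contourAround
  simp only [configProd, Multiset.map_replicate, Multiset.prod_replicate, abs_zero,
    Multiset.sum_replicate, smul_zero, add_zero, smul_eq_mul, Complex.ofReal_zero, sub_zero]
  congr 2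
  funext z
  by_cases hz : z = 0
  · simp [hz]
  · rw [one_div, one_div, inv_pow]
    field_simp
    ring

/-- The Newton polynomial `∏_{j ≤ n} (X - a_j)` of a configuration. -/
noncomputable def newtonPoly (ξ : Multiset ℝ) (n : ℕ) : Polynomial ℂ :=
  ((configTake ξ n).map fun a : ℝ => Polynomial.X - Polynomial.C (a : ℂ)).prod

lemma newtonPoly_eval (ξ : Multiset ℝ) (n : ℕ) (s : ℂ) :
    (newtonPoly ξ n).eval s = configProd (configTake ξ n) s := by
  simp [newtonPoly, configProd, Polynomial.eval_multiset_prod, Multiset.map_map]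

lemma newtonPoly_monic (ξ : Multiset ℝ) (n : ℕ) : (newtonPoly ξ n).Monic :=
  Polynomial.monic_multiset_prod_of_monic _ _ fun _ _ => Polynomial.monic_X_sub_C _

lemma newtonPoly_natDegree (ξ : Multiset ℝ) {n : ℕ} (hn : n ≤ ξ.card) :
    (newtonPoly ξ n).natDegree = n := by
  have : (newtonPoly ξ n).natDegree = (configTake ξ n).card := by
    unfold newtonPoly
    have h := Polynomial.natDegree_multiset_prod_X_sub_C_eq_card
      ((configTake ξ n).map (fun a : ℝ => (a : ℂ)))
    rw [Multiset.map_map, Multiset.card_map] at h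
    exact h
  rw [this, configTake]
  simpa using hn

/-! ### Bordered Vandermonde determinants -/

lemma hProd_eq_det {N : ℕ} (a : Fin N → ℝ) :
    (hProd a : ℂ) = (Matrix.of fun m k : Fin N => (a k : ℂ) ^ (m : ℕ)).det := by
  have h : (Matrix.of fun m k : Fin N => (a k : ℂ) ^ (m : ℕ)) =
      (Matrix.vandermonde fun k => (a k : ℂ)).transpose := by
    ext; simp [Matrix.vandermonde_apply]
  rw [h, Matrix.det_transpose, Matrix.det_vandermonde, hProd]
  push_cast
  rfl

/-- The bordered Vandermonde determinant attached to row functions `f`, columns `b` and a corner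
`P`: up to sign it is the product of `hProd` and of the determinant of a correlation kernel. -/
noncomputable def borderedDet {N : ℕ} {ι : Type*} [Fintype ι] [DecidableEq ι] (f : ι → ℂ → ℂ)
    (b : ι → ℕ → ℂ) (P : ι → ι → ℂ) (a : Fin N → ℝ) : ℂ :=
  (Matrix.fromBlocks (Matrix.of fun m k : Fin N => (a k : ℂ) ^ (m : ℕ))
    (Matrix.of fun (m : Fin N) q => b q m) (Matrix.of fun p k => f p (a k)) (Matrix.of P)).det

/-- The kernel is the Schur complement that remains after Newton interpolation has eliminated the
Vandermonde block of `borderedDet`. -/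
lemma det_kernel_mul_hProd {N : ℕ} {ι : Type*} [Fintype ι] [DecidableEq ι] (f : ι → ℂ → ℂ)
    (hf : ∀ p, Differentiable ℂ (f p)) (b : ι → ℕ → ℂ) (P : ι → ι → ℂ) (a : Fin N → ℝ) :
    (Matrix.of fun p q : ι => (∑ n ∈ Finset.range (configOf a).card,
      contourAround (configTake (configOf a) (n + 1))
        (fun s => f p s * (1 / configProd (configTake (configOf a) (n + 1)) s)) *
        (newtonPoly (configOf a) n).sum fun m c => c * b q m) - P p q).det * hProd a =
      (-1) ^ Fintype.card ι * borderedDet f b P a := by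
  have hcard : (configOf a).card = N := by simp [configOf]
  have hmem : ∀ k, a k ∈ configOf a := fun k => Multiset.mem_map_of_mem _ (Finset.mem_univ k)
  set ξ := configOf a with hξ
  let A : Matrix ι (Fin N) ℂ := Matrix.of fun p n => contourAround (configTake ξ (n + 1))
        (fun s => f p s * (1 / configProd (configTake ξ (n + 1)) s))
  let U : Matrix (Fin N) (Fin N) ℂ := Matrix.of fun n m => (newtonPoly ξ n).coeff m
  let V : Matrix (Fin N) (Fin N) ℂ := Matrix.of fun m k => (a k : ℂ) ^ (m : ℕ)
  let B : Matrix (Fin N) ι ℂ := Matrix.of fun m q => b q m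
  let F : Matrix ι (Fin N) ℂ := Matrix.of fun p k => f p (a k)
  have hdeg : ∀ n : Fin N, (newtonPoly ξ n).natDegree = n := fun n =>
    newtonPoly_natDegree ξ (by rw [hcard]; exact n.2.le)
  have hsum : ∀ (n : Fin N) (g : ℕ → ℂ → ℂ), (∀ i, g i 0 = 0) →
      (newtonPoly ξ n).sum g = ∑ m : Fin N, g m ((newtonPoly ξ n).coeff m) := by
    intro n g hg
    rw [Polynomial.sum_over_range' _ hg N (by rw [hdeg]; exact n.2), Finset.sum_range]
  have hUdet : U.det = 1 := by
    rw [Matrix.det_of_isLowerTriangular]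
    · refine Finset.prod_eq_one fun n _ => ?_
      have := newtonPoly_monic ξ n
      rw [Polynomial.Monic, Polynomial.leadingCoeff, hdeg] at this
      exact this
    · intro i j hij
      exact Polynomial.coeff_eq_zero_of_natDegree_lt ((hdeg i).trans_lt hij)
  have hW : ∀ n k : Fin N, (U * V) n k = configProd (configTake ξ n) (a k) := by
    intro n k
    rw [← newtonPoly_eval, Polynomial.eval_eq_sum, hsum n _ (by simp)]
    rfl
  have hAW : A * (U * V) = F := by
    ext p k
    rw [Matrix.mul_apply]
    have := newton_interpolation ξ (hf p) (hmem k)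
    rw [hcard, Finset.sum_range] at this
    rw [Finset.sum_congr rfl fun n _ => by rw [hW]]
    exact this
  have hK : (Matrix.of fun p q : ι => (∑ n ∈ Finset.range ξ.card,
      contourAround (configTake ξ (n + 1))
        (fun s => f p s * (1 / configProd (configTake ξ (n + 1)) s)) *
        (newtonPoly ξ n).sum fun m c => c * b q m) - P p q) = -(Matrix.of P - A * (U * B)) := by
    ext p q
    rw [neg_sub, Matrix.sub_apply, Matrix.mul_apply, Matrix.of_apply, hcard, Finset.sum_range]
    congr 1
    refine Finset.sum_congr rfl fun n _ => ?_
    rw [hsum n _ (by simp)]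
    rfl
  have h1 : Matrix.fromBlocks (U * V) (U * B) F (Matrix.of P) =
      Matrix.fromBlocks U 0 0 1 * Matrix.fromBlocks V B F (Matrix.of P) := by
    simp [Matrix.fromBlocks_multiply]
  have h2 : Matrix.fromBlocks (U * V) (U * B) F (Matrix.of P) =
      Matrix.fromBlocks 1 (U * B) A (Matrix.of P) * Matrix.fromBlocks (U * V) 0 0 1 := by
    simp [Matrix.fromBlocks_multiply, hAW]
  have h3 := congrArg Matrix.det (h1.symm.trans h2)
  rw [Matrix.det_mul, Matrix.det_mul, Matrix.det_fromBlocks_zero₂₁, Matrix.det_fromBlocks_zero₂₁,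
    Matrix.det_fromBlocks_one₁₁, Matrix.det_mul, hUdet] at h3
  simp only [Matrix.det_one, one_mul, mul_one] at h3
  rw [hK, Matrix.det_neg, hProd_eq_det, mul_assoc]
  congr 1
  exact h3.symm

/-- The analogue of `det_kernel_mul_hProd` for a kernel of the form `C B - P`. -/
lemma det_fromBlocks_mul_mul {N : ℕ} {ι : Type*} [Fintype ι] [DecidableEq ι]
    (D T : Matrix (Fin N) (Fin N) ℂ) (C : Matrix ι (Fin N) ℂ) (B : Matrix (Fin N) ι ℂ)
    (P : Matrix ι ι ℂ) :
    (-1) ^ Fintype.card ι * (Matrix.fromBlocks (D * T) (D * B) (C * T) P).det =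
      D.det * T.det * (C * B - P).det := by
  have h : Matrix.fromBlocks (D * T) (D * B) (C * T) P =
      Matrix.fromBlocks D 0 0 1 * Matrix.fromBlocks 1 B C P * Matrix.fromBlocks T 0 0 1 := by
    simp [Matrix.fromBlocks_multiply]
  have h2 : C * B - P = -(P - C * B) := by simp
  rw [h, Matrix.det_mul, Matrix.det_mul, Matrix.det_fromBlocks_zero₂₁,
    Matrix.det_fromBlocks_zero₂₁, Matrix.det_fromBlocks_one₁₁, h2, Matrix.det_neg]
  simp only [Matrix.det_one, mul_one]
  ring

/-! ### Integration over the Weyl chamber -/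

lemma ae_injective (N : ℕ) : ∀ᵐ a : Fin N → ℝ, Function.Injective a := by
  have h : ∀ i j : Fin N, i ≠ j → ∀ᵐ a : Fin N → ℝ, a i ≠ a j := by
    intro i j hij
    let S : Submodule ℝ (Fin N → ℝ) :=
      LinearMap.ker (LinearMap.proj (R := ℝ) (φ := fun _ : Fin N => ℝ) i - LinearMap.proj j)
    have hS : S ≠ ⊤ := by
      intro hS
      have : Pi.single i (1 : ℝ) ∈ S := hS ▸ Submodule.mem_top
      simp [S, hij.symm] at this
    have := Measure.addHaar_submodule (volume : Measure (Fin N → ℝ)) S hS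
    rw [ae_iff]
    convert this using 2
    ext a
    simp [S, sub_eq_zero]
  have h2 : ∀ᵐ a : Fin N → ℝ, ∀ i j : Fin N, i ≠ j → a i ≠ a j := by
    rw [ae_all_iff]; intro i
    rw [ae_all_iff]; intro j
    by_cases hij : i = j
    · simp [hij]
    · filter_upwards [h i j hij] with a ha _ using ha
  filter_upwards [h2] with a ha i j hij
  by_contra hne
  exact ha i j hne hij

lemma measurableSet_chamberA (N : ℕ) : MeasurableSet (chamberA N) := by
  have : chamberA N = ⋂ i : Fin N, ⋂ j : Fin N, ⋂ _ : i < j, {a | a i < a j} := by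
    ext a
    simp [chamberA, StrictMono]
  rw [this]
  refine MeasurableSet.iInter fun i => MeasurableSet.iInter fun j => MeasurableSet.iInter fun _ =>
    measurableSet_lt (measurable_pi_apply i) (measurable_pi_apply j)

lemma measurePreserving_comp_perm {N : ℕ} (τ : Equiv.Perm (Fin N)) :
    MeasurePreserving (fun a : Fin N → ℝ => a ∘ τ) := by
  have := volume_measurePreserving_piCongrLeft (fun _ : Fin N => ℝ) τ.symm
  have h : ⇑(MeasurableEquiv.piCongrLeft (fun _ : Fin N => ℝ) τ.symm) = fun a => a ∘ τ := by
    funext a i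
    simp [MeasurableEquiv.coe_piCongrLeft, Equiv.piCongrLeft_apply]
  rwa [h] at this

/-- The images of the chamber under the permutations of the coordinates tile the space. -/
lemma sum_integral_chamberA {N : ℕ} {g : (Fin N → ℝ) → ℂ} (hg : Integrable g) :
    ∑ τ : Equiv.Perm (Fin N), ∫ a in chamberA N, g (a ∘ τ) = ∫ a, g a := by
  have hm := measurableSet_chamberA N
  have h1 : ∀ τ : Equiv.Perm (Fin N), ∫ a in chamberA N, g (a ∘ τ) =
      ∫ a, (chamberA N).indicator (fun _ => (1 : ℂ)) (a ∘ τ.symm) * g a := by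
    intro τ
    let e : (Fin N → ℝ) ≃ᵐ (Fin N → ℝ) :=
      MeasurableEquiv.piCongrLeft (fun _ : Fin N => ℝ) τ.symm
    have he : ∀ a, e a = a ∘ τ := by
      intro a
      funext i
      simp [e, MeasurableEquiv.coe_piCongrLeft, Equiv.piCongrLeft_apply]
    have hmp : MeasurePreserving e := volume_measurePreserving_piCongrLeft _ _
    rw [← integral_indicator hm, ← hmp.integral_comp'
      (g := fun a => (chamberA N).indicator (fun _ => (1 : ℂ)) (a ∘ τ.symm) * g a)]
    refine integral_congr_ae (Filter.Eventually.of_forall fun a => ?_)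
    have : (a ∘ τ) ∘ τ.symm = a := by funext i; simp
    simp only [he, this]
    by_cases ha : a ∈ chamberA N <;> simp [ha]
  have hi : ∀ τ : Equiv.Perm (Fin N), Integrable
      (fun a => (chamberA N).indicator (fun _ => (1 : ℂ)) (a ∘ τ.symm) * g a) := by
    intro τ
    refine hg.bdd_mul (c := 1) ?_ ?_
    · exact ((measurable_const.indicator hm).comp
        (measurePreserving_comp_perm τ.symm).measurable).aestronglyMeasurable
    · refine Filter.Eventually.of_forall fun a => ?_
      by_cases ha : (a ∘ τ.symm) ∈ chamberA N <;> simp [ha]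
  rw [Finset.sum_congr rfl fun τ _ => h1 τ, ← integral_finsetSum _ fun τ _ => hi τ]
  refine integral_congr_ae ?_
  filter_upwards [ae_injective N] with a ha
  rw [← Finset.sum_mul]
  have hs : StrictMono (a ∘ Tuple.sort a) :=
    (Tuple.monotone_sort a).strictMono_of_injective (ha.comp (Tuple.sort a).injective)
  rw [Finset.sum_eq_single (Tuple.sort a).symm]
  · have : a ∘ Tuple.sort a ∈ chamberA N := hs
    simp [this]
  · intro τ _ hτ
    have : a ∘ τ.symm ∉ chamberA N := by
      intro h
      apply hτ
      have h' : StrictMono (a ∘ τ.symm) := h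
      have := Tuple.unique_monotone h'.monotone (Tuple.monotone_sort a)
      have h3 : τ.symm = Tuple.sort a := by
        ext i
        exact congrArg Fin.val (ha (congrFun this i))
      rw [← h3, Equiv.symm_symm]
    simp [this]
  · simp

lemma borderedDet_comp_perm {N : ℕ} {ι : Type*} [Fintype ι] [DecidableEq ι] (f : ι → ℂ → ℂ)
    (b : ι → ℕ → ℂ) (P : ι → ι → ℂ) (a : Fin N → ℝ) (τ : Equiv.Perm (Fin N)) :
    borderedDet f b P (a ∘ τ) = (Equiv.Perm.sign τ : ℤ) * borderedDet f b P a := by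
  unfold borderedDet
  have hs : Equiv.Perm.sign τ = Equiv.Perm.sign (Equiv.Perm.sumCongr τ (1 : Equiv.Perm ι)) := by
    simp
  rw [hs, ← Matrix.det_permute']
  congr 1
  ext (i | i) (j | j) <;> simp

/-- Expansion of `borderedDet` into products of functions of a single coordinate. -/
lemma borderedDet_eq_sum {N : ℕ} {ι : Type*} [Fintype ι] [DecidableEq ι] (f : ι → ℂ → ℂ)
    (b : ι → ℕ → ℂ) (P : ι → ι → ℂ) (a : Fin N → ℝ) :
    borderedDet f b P a = ∑ ρ : Equiv.Perm (Fin N ⊕ ι), (Equiv.Perm.sign ρ : ℤ) *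
      ((∏ k : Fin N, Sum.elim (fun m : Fin N => (a k : ℂ) ^ (m : ℕ)) (fun p => f p (a k))
        (ρ (Sum.inl k))) *
      ∏ q : ι, Sum.elim (fun m : Fin N => b q m) (fun p => P p q) (ρ (Sum.inr q))) := by
  unfold borderedDet
  rw [Matrix.det_apply']
  refine Finset.sum_congr rfl fun ρ _ => ?_
  rw [Fintype.prod_sum_type]
  congr 2
  · refine Finset.prod_congr rfl fun k _ => ?_
    rcases ρ (Sum.inl k) with m | p <;> simp
  · refine Finset.prod_congr rfl fun q _ => ?_
    rcases ρ (Sum.inr q) with m | p <;> simp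

/-- Andréief's identity: as each coordinate occurs in one column only, a bordered determinant may be
integrated column by column. -/
lemma integral_prod_mul_borderedDet {N : ℕ} {ι : Type*} [Fintype ι] [DecidableEq ι] (f : ι → ℂ → ℂ)
    (b : ι → ℕ → ℂ) (P : ι → ι → ℂ) (w : Fin N → ℝ → ℂ)
    (hw : ∀ (i : ℕ) k, Integrable fun a : ℝ => (a : ℂ) ^ i * w k a)
    (hfw : ∀ p k, Integrable fun a : ℝ => f p a * w k a) :
    Integrable (fun a : Fin N → ℝ => (∏ k, w k (a k)) * borderedDet f b P a) ∧
    ∫ a : Fin N → ℝ, (∏ k, w k (a k)) * borderedDet f b P a =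
      (Matrix.fromBlocks (Matrix.of fun m k : Fin N => ∫ a : ℝ, (a : ℂ) ^ (m : ℕ) * w k a)
        (Matrix.of fun (m : Fin N) q => b q m) (Matrix.of fun p k => ∫ a : ℝ, f p a * w k a)
        (Matrix.of P)).det := by
  let R : Fin N ⊕ ι → Fin N → ℝ → ℂ := fun c k a =>
    Sum.elim (fun m : Fin N => (a : ℂ) ^ (m : ℕ)) (fun p => f p a) c * w k a
  have hR : ∀ c k, Integrable (R c k) := by
    rintro (m | p) k
    · exact hw m k
    · exact hfw p k
  have hexp : (fun a : Fin N → ℝ => (∏ k, w k (a k)) * borderedDet f b P a) = fun a =>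
      ∑ ρ : Equiv.Perm (Fin N ⊕ ι), ((Equiv.Perm.sign ρ : ℤ) *
        ∏ q : ι, Sum.elim (fun m : Fin N => b q m) (fun p => P p q) (ρ (Sum.inr q))) *
        ∏ k : Fin N, R (ρ (Sum.inl k)) k (a k) := by
    funext a
    rw [borderedDet_eq_sum, Finset.mul_sum]
    refine Finset.sum_congr rfl fun ρ _ => ?_
    simp only [R, Finset.prod_mul_distrib]
    ring
  have hint : ∀ ρ : Equiv.Perm (Fin N ⊕ ι), Integrable (fun a : Fin N → ℝ =>
      ((Equiv.Perm.sign ρ : ℤ) *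
        ∏ q : ι, Sum.elim (fun m : Fin N => b q m) (fun p => P p q) (ρ (Sum.inr q))) *
        ∏ k : Fin N, R (ρ (Sum.inl k)) k (a k)) := fun ρ =>
    (Integrable.fintype_prod (f := fun k => R (ρ (Sum.inl k)) k) fun k => hR _ k).const_mul _
  rw [hexp]
  refine ⟨integrable_finsetSum _ fun ρ _ => hint ρ, ?_⟩
  rw [integral_finsetSum _ fun ρ _ => hint ρ, Matrix.det_apply']
  refine Finset.sum_congr rfl fun ρ _ => ?_
  rw [integral_const_mul, integral_fintype_prod_volume_eq_prod (fun k => R (ρ (Sum.inl k)) k),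
    Fintype.prod_sum_type, mul_assoc, mul_comm (∏ q : ι, _)]
  congr 2
  · refine Finset.prod_congr rfl fun k _ => ?_
    rcases h : ρ (Sum.inl k) with m | p <;> simp [R]
  · refine Finset.prod_congr rfl fun q _ => ?_
    rcases ρ (Sum.inr q) with m | p <;> simp

/-- The mean of the determinant of a kernel over a random configuration with one-particle weight `w`
and density proportional to `(∏ k, w (a k)) * hProd a ^ 2`, provided the moments of `w`, the
integrals of the row functions `f` and the columns `b` factor through common matrices `D` and
`T`. -/
theorem expect_det {N : ℕ} {ι : Type*} [Fintype ι] [DecidableEq ι] (w : ℝ → ℂ) (Z : ℂ)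
    (f : ι → ℂ → ℂ) (hf : ∀ p, Differentiable ℂ (f p)) (b : ι → ℕ → ℂ) (P : ι → ι → ℂ)
    (hw : ∀ k : ℕ, Integrable fun a : ℝ => (a : ℂ) ^ k * w a)
    (hfw : ∀ p (k : ℕ), Integrable fun a : ℝ => f p a * ((a : ℂ) ^ k * w a))
    (D T : Matrix (Fin N) (Fin N) ℂ) (C : Matrix ι (Fin N) ℂ) (B : Matrix (Fin N) ι ℂ)
    (hG : ∀ m k : Fin N, ∫ a : ℝ, (a : ℂ) ^ (m + k : ℕ) * w a = (D * T) m k)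
    (hQ : ∀ p (k : Fin N), ∫ a : ℝ, f p a * ((a : ℂ) ^ (k : ℕ) * w a) = (C * T) p k)
    (hB : ∀ (m : Fin N) q, b q m = (D * B) m q) (hZ : Z * (D.det * T.det) = 1)
    (K : Multiset ℝ → ι → ι → ℂ)
    (hK : ∀ ξ p q, K ξ p q = (∑ n ∈ Finset.range ξ.card,
      contourAround (configTake ξ (n + 1))
        (fun s => f p s * (1 / configProd (configTake ξ (n + 1)) s)) *
        (newtonPoly ξ n).sum fun m c => c * b q m) - P p q) :
    IntegrableOn (fun a : Fin N → ℝ => (Matrix.of (K (configOf a))).det *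
      (Z * (∏ k, w (a k)) * (hProd a : ℂ) ^ 2)) (chamberA N) ∧
    ∫ a in chamberA N, (Matrix.of (K (configOf a))).det *
      (Z * (∏ k, w (a k)) * (hProd a : ℂ) ^ 2) = (C * B - Matrix.of P).det := by
  let g : (Fin N → ℝ) → ℂ := fun a =>
    (∏ k : Fin N, (fun x : ℝ => (x : ℂ) ^ (k : ℕ) * w x) (a k)) * borderedDet f b P a
  obtain ⟨hgi, hgv⟩ := integral_prod_mul_borderedDet f b P
    (fun (k : Fin N) (x : ℝ) => (x : ℂ) ^ (k : ℕ) * w x)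
    (fun i k => by simpa [← mul_assoc, ← pow_add] using hw (i + k)) (fun p k => hfw p k)
  have hexp : ∀ a : Fin N → ℝ, (Matrix.of (K (configOf a))).det *
      (Z * (∏ k, w (a k)) * (hProd a : ℂ) ^ 2) =
      ((-1) ^ Fintype.card ι * Z) * ∑ τ : Equiv.Perm (Fin N), g (a ∘ τ) := by
    intro a
    have hKa : (Matrix.of (K (configOf a))).det * hProd a =
        (-1) ^ Fintype.card ι * borderedDet f b P a := by
      rw [← det_kernel_mul_hProd f hf b P a]
      congr 2
      ext p q
      exact hK _ p q
    -- one factor `hProd a` is the antisymmetrization of `∏ k, (a k) ^ k`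
    have hsum : ∑ τ : Equiv.Perm (Fin N), g (a ∘ τ) =
        hProd a * ((∏ k, w (a k)) * borderedDet f b P a) := by
      rw [hProd_eq_det, ← Matrix.det_transpose, Matrix.det_apply', Finset.sum_mul]
      refine Finset.sum_congr rfl fun τ _ => ?_
      simp only [g, borderedDet_comp_perm, Finset.prod_mul_distrib, Function.comp_apply,
        Equiv.prod_comp τ (fun k => w (a k)), Matrix.transpose_apply, Matrix.of_apply]
      ring
    rw [hsum]
    linear_combination (Z * (∏ k, w (a k)) * hProd a) * hKa
  have hgτ : ∀ τ : Equiv.Perm (Fin N), Integrable fun a => g (a ∘ τ) := fun τ =>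
    (measurePreserving_comp_perm τ).integrable_comp_of_integrable hgi
  simp_rw [hexp]
  refine ⟨((integrable_finsetSum _ fun τ _ => hgτ τ).const_mul _).integrableOn, ?_⟩
  rw [integral_const_mul, integral_finsetSum _ fun τ _ => (hgτ τ).integrableOn,
    sum_integral_chamberA hgi, hgv]
  have h1 : (Matrix.of fun m k : Fin N => ∫ a : ℝ, (a : ℂ) ^ (m : ℕ) * ((a : ℂ) ^ (k : ℕ) * w a))
      = D * T := by
    ext m k
    rw [← hG, Matrix.of_apply]
    simp [← mul_assoc, ← pow_add]
  have h2 : (Matrix.of fun p (k : Fin N) => ∫ a : ℝ, f p a * ((a : ℂ) ^ (k : ℕ) * w a)) = C * T := by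
    ext p k; exact hQ p k
  have h3 : (Matrix.of fun (m : Fin N) q => b q m) = D * B := by
    ext m q; exact hB m q
  rw [h1, h2, h3, mul_comm _ Z, mul_assoc, det_fromBlocks_mul_mul]
  linear_combination (C * B - Matrix.of P).det * hZ

/-! ### Absolutely convergent power series -/

/-- A truncated lower triangular Toeplitz matrix acts by convolution. -/
lemma sum_fin_toeplitz {N m : ℕ} (hm : m < N) (e x : ℕ → ℂ) :
    ∑ n : Fin N, (if (n : ℕ) ≤ m then e (m - n) else 0) * x n =
      ∑ ij ∈ Finset.HasAntidiagonal.antidiagonal m, e ij.1 * x ij.2 := by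
  rw [← Finset.sum_range fun n => (if n ≤ m then e (m - n) else 0) * x n,
    ← Finset.Nat.sum_antidiagonal_swap]
  simp only [Prod.fst_swap, Prod.snd_swap]
  rw [Finset.Nat.sum_antidiagonal_eq_sum_range_succ (fun i j => e j * x i)]
  symm
  refine Finset.sum_subset_zero_on_sdiff (Finset.range_subset_range.2 hm) ?_ ?_
  · intro n hn
    simp only [Finset.mem_sdiff, Finset.mem_range, not_lt] at hn
    rw [if_neg (by omega), zero_mul]
  · intro n hn
    rw [if_pos (by simpa [Nat.lt_succ_iff] using hn)]

/-- The power series `p` converges absolutely at `z`, with sum `S`. -/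
def PowerSeries.AbsSumsTo (p : PowerSeries ℂ) (z S : ℂ) : Prop :=
  Summable (fun n => ‖PowerSeries.coeff n p * z ^ n‖) ∧
    HasSum (fun n => PowerSeries.coeff n p * z ^ n) S

lemma PowerSeries.AbsSumsTo.mul {p q : PowerSeries ℂ} {z S R : ℂ} (hp : p.AbsSumsTo z S)
    (hq : q.AbsSumsTo z R) : (p * q).AbsSumsTo z (S * R) := by
  have h : ∀ n, PowerSeries.coeff n (p * q) * z ^ n = ∑ kl ∈ Finset.HasAntidiagonal.antidiagonal n,
      (PowerSeries.coeff kl.1 p * z ^ kl.1) * (PowerSeries.coeff kl.2 q * z ^ kl.2) := by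
    intro n
    rw [PowerSeries.coeff_mul, Finset.sum_mul]
    refine Finset.sum_congr rfl fun kl hkl => ?_
    rw [← Finset.HasAntidiagonal.mem_antidiagonal.1 hkl]
    ring
  have hs := summable_norm_sum_mul_antidiagonal_of_summable_norm hp.1 hq.1
  refine ⟨by simpa only [h] using hs, ?_⟩
  simp_rw [h]
  rw [← hp.2.tsum_eq, ← hq.2.tsum_eq,
    tsum_mul_tsum_eq_tsum_sum_antidiagonal_of_summable_norm hp.1 hq.1]
  exact hs.of_norm.hasSum

lemma absSumsTo_rescale_exp (a z : ℂ) :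
    (PowerSeries.rescale a (PowerSeries.exp ℂ)).AbsSumsTo z (Complex.exp (a * z)) := by
  have h : ∀ n, PowerSeries.coeff n (PowerSeries.rescale a (PowerSeries.exp ℂ)) * z ^ n =
      (a * z) ^ n / (n.factorial : ℂ) := by
    intro n
    simp [PowerSeries.coeff_rescale, PowerSeries.coeff_exp, mul_pow]
    ring
  unfold PowerSeries.AbsSumsTo
  simp_rw [h]
  refine ⟨NormedSpace.norm_expSeries_div_summable (a * z), ?_⟩
  rw [Complex.exp_eq_exp_ℂ]
  exact NormedSpace.expSeries_div_hasSum_exp (a * z)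

/-! ### Heat polynomials -/

section Heat

variable {A : Type*} [CommRing A] [Algebra ℚ A]

/-- The formal power series `exp (v X² / 2)`. -/
noncomputable def gaussSeries (v : A) : PowerSeries A :=
  PowerSeries.expand 2 two_ne_zero
    (PowerSeries.rescale (algebraMap ℚ A (1 / 2) * v) (PowerSeries.exp A))

/-- The formal power series `exp (μ X + v X² / 2)`, the exponential generating function of the
moments of a Gaussian variable of mean `μ` and variance `v`. -/
noncomputable def heatSeries (μ v : A) : PowerSeries A :=
  PowerSeries.rescale μ (PowerSeries.exp A) * gaussSeries v

lemma gaussSeries_add (v w : A) : gaussSeries (v + w) = gaussSeries v * gaussSeries w := by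
  unfold gaussSeries
  rw [← map_mul, PowerSeries.exp_mul_exp_eq_exp_add, mul_add]

lemma heatSeries_add_right (μ v w : A) :
    heatSeries μ (v + w) = gaussSeries v * heatSeries μ w := by
  rw [heatSeries, gaussSeries_add, heatSeries]
  ring

lemma coeff_gaussSeries (v : A) (n : ℕ) : PowerSeries.coeff n (gaussSeries v) =
    if 2 ∣ n then (algebraMap ℚ A (1 / 2) * v) ^ (n / 2) * algebraMap ℚ A (1 / (n / 2).factorial)
    else 0 := by
  unfold gaussSeries
  rw [PowerSeries.coeff_expand]
  simp [PowerSeries.coeff_rescale, PowerSeries.coeff_exp]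

lemma coeff_gaussSeries_zero (v : A) : PowerSeries.coeff 0 (gaussSeries v) = 1 := by
  simp [coeff_gaussSeries]

lemma coeff_gaussSeries_one (v : A) : PowerSeries.coeff 1 (gaussSeries v) = 0 := by
  simp [coeff_gaussSeries]

lemma coeff_gaussSeries_add_two (v : A) (n : ℕ) :
    ((n + 2 : ℕ) : A) * PowerSeries.coeff (n + 2) (gaussSeries v) =
      v * PowerSeries.coeff n (gaussSeries v) := by
  simp only [coeff_gaussSeries, (Nat.dvd_add_left (dvd_refl 2) : 2 ∣ n + 2 ↔ 2 ∣ n)]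
  split_ifs with h
  · obtain ⟨k, rfl⟩ := h
    have h1 : (2 * k + 2) / 2 = k + 1 := by omega
    have h2 : 2 * k / 2 = k := by omega
    have h3 : ((2 * k + 2 : ℕ) : A) = algebraMap ℚ A (2 * (k + 1)) := by
      push_cast [map_mul, map_add, map_one, map_natCast, map_ofNat]; ring
    rw [h1, h2, h3, pow_succ]
    have h4 : algebraMap ℚ A (2 * (k + 1)) * (algebraMap ℚ A (1 / 2) *
        algebraMap ℚ A (1 / (k + 1).factorial)) = algebraMap ℚ A (1 / k.factorial) := by
      rw [← map_mul, ← map_mul]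
      congr 1
      rw [Nat.factorial_succ]
      have : (k.factorial : ℚ) ≠ 0 := by exact_mod_cast k.factorial_ne_zero
      push_cast
      field_simp
    rw [← h4]
    ring
  · simp

lemma algebraMap_inv_factorial_succ (j : ℕ) :
    algebraMap ℚ A (1 / (j + 1).factorial) * ((j : A) + 1) = algebraMap ℚ A (1 / j.factorial) := by
  have h : ((j : A) + 1) = algebraMap ℚ A (j + 1) := by simp
  rw [h, ← map_mul]
  congr 1
  rw [Nat.factorial_succ]
  have : (j.factorial : ℚ) ≠ 0 := by exact_mod_cast j.factorial_ne_zero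
  push_cast
  field_simp

lemma derivative_gaussSeries (v : A) :
    PowerSeries.derivative A (gaussSeries v) = PowerSeries.C v * (PowerSeries.X * gaussSeries v) := by
  ext n
  rw [PowerSeries.coeff_derivative, PowerSeries.coeff_C_mul]
  rcases n with _ | n
  · simp [coeff_gaussSeries_one]
  · rw [PowerSeries.coeff_succ_X_mul, ← coeff_gaussSeries_add_two]
    push_cast
    ring

lemma derivative_heatSeries (μ v : A) : PowerSeries.derivative A (heatSeries μ v) =
    PowerSeries.C μ * heatSeries μ v + PowerSeries.C v * (PowerSeries.X * heatSeries μ v) := by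
  have h : PowerSeries.derivative A (PowerSeries.rescale μ (PowerSeries.exp A)) =
      PowerSeries.C μ * PowerSeries.rescale μ (PowerSeries.exp A) := by
    ext n
    rw [PowerSeries.coeff_derivative, PowerSeries.coeff_C_mul, PowerSeries.coeff_rescale,
      PowerSeries.coeff_rescale, PowerSeries.coeff_exp, PowerSeries.coeff_exp, pow_succ]
    rw [← algebraMap_inv_factorial_succ n]
    ring
  unfold heatSeries
  rw [Derivation.leibniz, derivative_gaussSeries, h]
  simp only [smul_eq_mul]
  ring

lemma coeff_heatSeries_zero (μ v : A) : PowerSeries.coeff 0 (heatSeries μ v) = 1 := by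
  unfold heatSeries
  rw [PowerSeries.coeff_mul]
  simp [coeff_gaussSeries_zero]

lemma coeff_heatSeries_one (μ v : A) : PowerSeries.coeff 1 (heatSeries μ v) = μ := by
  have := congrArg (PowerSeries.coeff 0) (derivative_heatSeries μ v)
  rw [PowerSeries.coeff_derivative, map_add, PowerSeries.coeff_C_mul, coeff_heatSeries_zero,
    PowerSeries.coeff_C_mul, PowerSeries.coeff_zero_X_mul] at this
  simpa using this

lemma coeff_heatSeries_add_two (μ v : A) (n : ℕ) :
    ((n : A) + 2) * PowerSeries.coeff (n + 2) (heatSeries μ v) =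
      μ * PowerSeries.coeff (n + 1) (heatSeries μ v) + v * PowerSeries.coeff n (heatSeries μ v) := by
  have := congrArg (PowerSeries.coeff (n + 1)) (derivative_heatSeries μ v)
  rw [PowerSeries.coeff_derivative, map_add, PowerSeries.coeff_C_mul, PowerSeries.coeff_C_mul,
    PowerSeries.coeff_succ_X_mul] at this
  rw [← this]
  push_cast
  ring

lemma rescale_heatSeries (ρ μ v : A) :
    PowerSeries.rescale ρ (heatSeries μ v) = heatSeries (ρ * μ) (ρ ^ 2 * v) := by
  have h : PowerSeries.rescale ρ (gaussSeries v) = gaussSeries (ρ ^ 2 * v) := by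
    ext n
    rw [PowerSeries.coeff_rescale, coeff_gaussSeries, coeff_gaussSeries]
    split_ifs with h
    · obtain ⟨k, rfl⟩ := h
      have h2 : 2 * k / 2 = k := by omega
      rw [h2, pow_mul, mul_pow, mul_pow, mul_pow]
      ring
    · simp
  rw [heatSeries, map_mul, h, heatSeries, PowerSeries.rescale_rescale, mul_comm μ]

/-- Wick's formula: mixed moments `E[Z^m Z^k]` of a centred Gaussian variable, expanded according
to the number `j` of pairings between the two factors. -/
lemma wick (v : A) (m k : ℕ) :
    (m.factorial : A) * k.factorial * ∑ ij ∈ Finset.HasAntidiagonal.antidiagonal k,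
      PowerSeries.coeff ij.1 (gaussSeries v) * (if ij.2 ≤ m then
        PowerSeries.coeff (m - ij.2) (gaussSeries v) * (v ^ ij.2 *
          algebraMap ℚ A (1 / ij.2.factorial)) else 0) =
      (m + k).factorial * PowerSeries.coeff (m + k) (gaussSeries v) := by
  -- the `m`-th derivative of `exp (v Y² / 2)` is `m!` times that series times `p m`, where
  -- `∑ p m z^m = exp (v Y z + v z² / 2)`
  let p : ℕ → PowerSeries A := fun m =>
    PowerSeries.coeff m (heatSeries (PowerSeries.C v * PowerSeries.X) (PowerSeries.C v))
  let G : ℕ → PowerSeries A := fun m => (PowerSeries.derivative A)^[m] (gaussSeries v)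
  have hp : ∀ m j, PowerSeries.coeff j (p m) = if j ≤ m then
        PowerSeries.coeff (m - j) (gaussSeries v) * (v ^ j *
          algebraMap ℚ A (1 / j.factorial)) else 0 := by
    intro m j
    have hC : ∀ n, PowerSeries.coeff n (gaussSeries (PowerSeries.C v)) =
        PowerSeries.C (PowerSeries.coeff n (gaussSeries v)) := by
      intro n
      rw [coeff_gaussSeries, coeff_gaussSeries]
      split_ifs with h
      · simp only [map_mul, map_pow, PowerSeries.algebraMap_apply]
      · simp
    have hterm : ∀ i l, PowerSeries.coeff i (PowerSeries.rescale (PowerSeries.C v * PowerSeries.X)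
        (PowerSeries.exp (PowerSeries A))) * PowerSeries.coeff l (gaussSeries (PowerSeries.C v)) =
        PowerSeries.C (v ^ i * algebraMap ℚ A (1 / i.factorial) *
          PowerSeries.coeff l (gaussSeries v)) * PowerSeries.X ^ i := by
      intro i l
      rw [hC, PowerSeries.coeff_rescale, PowerSeries.coeff_exp, mul_pow,
        PowerSeries.algebraMap_apply]
      simp only [map_mul, map_pow]
      ring
    simp only [p, heatSeries]
    rw [PowerSeries.coeff_mul, Finset.Nat.sum_antidiagonal_eq_sum_range_succ_mk]
    simp only [hterm, map_sum, PowerSeries.coeff_C_mul, PowerSeries.coeff_X_pow]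
    rw [Finset.sum_congr rfl fun i _ => mul_ite _ _ _ _]
    simp only [mul_one, mul_zero, Finset.sum_ite_eq, Finset.mem_range, Nat.lt_succ_iff]
    split_ifs
    · ring
    · rfl
  have hpd : ∀ m, PowerSeries.derivative A (p (m + 1)) = PowerSeries.C v * p m := by
    intro m
    ext j
    rw [PowerSeries.coeff_derivative, PowerSeries.coeff_C_mul, hp, hp]
    simp only [Nat.add_le_add_iff_right, Nat.add_sub_add_right]
    split_ifs
    · rw [← algebraMap_inv_factorial_succ j]
      ring
    · simp
  have hG : ∀ m, G m = (m.factorial : PowerSeries A) * (gaussSeries v * p m) := by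
    intro m
    induction m with
    | zero => simp [G, p, coeff_heatSeries_zero]
    | succ m ih =>
      have h1 : G (m + 1) = PowerSeries.derivative A (G m) := by
        simp only [G, Function.iterate_succ_apply']
      rw [h1, ih, Derivation.leibniz, Derivation.leibniz, Derivation.map_natCast,
        derivative_gaussSeries]
      simp only [smul_eq_mul, mul_zero, add_zero]
      rcases m with _ | m
      · simp [p, coeff_heatSeries_zero, coeff_heatSeries_one]
        ring
      · have h2 := coeff_heatSeries_add_two (PowerSeries.C v * PowerSeries.X) (PowerSeries.C v) m
        rw [hpd, Nat.factorial_succ (m + 1)]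
        simp only [p]
        push_cast
        linear_combination (-((m + 1).factorial : PowerSeries A) * gaussSeries v) * h2
  have h3 := congrArg (PowerSeries.coeff k) (hG m)
  have hnat : ((m.factorial : ℕ) : PowerSeries A) = PowerSeries.C (m.factorial : A) := by simp
  rw [hnat, PowerSeries.coeff_C_mul, PowerSeries.coeff_mul] at h3
  simp only [hp, G, PowerSeries.coeff_iterate_derivative] at h3
  rw [mul_comm (m.factorial : A), mul_assoc, ← h3, ← mul_assoc, add_comm m k]
  norm_cast
  rw [Nat.factorial_mul_ascFactorial]

end Heat

lemma PowerSeries.AbsSumsTo.expand_two {p : PowerSeries ℂ} {z S : ℂ} (hp : p.AbsSumsTo (z ^ 2) S) :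
    (PowerSeries.expand 2 two_ne_zero p).AbsSumsTo z S := by
  have hinj : Function.Injective fun n : ℕ => 2 * n := fun a b h => by simpa using h
  have hz : ∀ n, n ∉ Set.range (fun n : ℕ => 2 * n) →
      PowerSeries.coeff n (PowerSeries.expand 2 two_ne_zero p) * z ^ n = 0 := by
    intro n hn
    rw [PowerSeries.coeff_expand, if_neg, zero_mul]
    rintro ⟨k, rfl⟩
    exact hn ⟨k, rfl⟩
  have hc : ∀ n, PowerSeries.coeff (2 * n) (PowerSeries.expand 2 two_ne_zero p) * z ^ (2 * n) =
      PowerSeries.coeff n p * (z ^ 2) ^ n := by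
    intro n
    rw [PowerSeries.coeff_expand_mul, pow_mul]
  constructor
  · rw [← hinj.summable_iff (fun n hn => by rw [hz n hn, norm_zero])]
    simpa only [Function.comp_def, hc] using hp.1
  · rw [← hinj.hasSum_iff hz]
    simpa only [Function.comp_def, hc] using hp.2

lemma absSumsTo_gaussSeries (v z : ℂ) :
    (gaussSeries v).AbsSumsTo z (Complex.exp (v * z ^ 2 / 2)) := by
  have := (absSumsTo_rescale_exp (algebraMap ℚ ℂ (1 / 2) * v) (z ^ 2)).expand_two
  have h : v * z ^ 2 / 2 = algebraMap ℚ ℂ (1 / 2) * v * z ^ 2 := by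
    rw [eq_ratCast]
    push_cast
    ring
  rw [h]
  exact this

lemma absSumsTo_heatSeries (μ v z : ℂ) :
    (heatSeries μ v).AbsSumsTo z (Complex.exp (μ * z + v * z ^ 2 / 2)) := by
  rw [Complex.exp_add]
  exact (absSumsTo_rescale_exp μ z).mul (absSumsTo_gaussSeries v z)

/-! ### Gaussian moments -/

lemma integrable_pow_mul_cexp {c : ℝ} (hc : 0 < c) (β : ℂ) (m : ℕ) :
    Integrable fun s : ℝ => (s : ℂ) ^ m * Complex.exp (-(c : ℂ) / 2 * s ^ 2 + β * s) := by
  have h : ∀ γ : ℂ, Integrable fun s : ℝ => Complex.exp (-(c : ℂ) / 2 * s ^ 2 + γ * s) := by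
    intro γ
    have := integrable_cexp_quadratic (b := (c : ℂ) / 2) (by simpa using hc) γ 0
    simpa [neg_div] using this
  refine (((h (β + 1)).norm.add (h (β - 1)).norm).const_mul (m.factorial : ℝ)).mono'
    (by fun_prop) (Filter.Eventually.of_forall fun s => ?_)
  have h1 : |s| ^ m ≤ m.factorial * (Real.exp s + Real.exp (-s)) := by
    have h2 := Real.pow_div_factorial_le_exp |s| (abs_nonneg s) m
    rw [div_le_iff₀ (by positivity)] at h2
    have h3 : Real.exp |s| ≤ Real.exp s + Real.exp (-s) := by
      rcases abs_cases s with ⟨h, _⟩ | ⟨h, _⟩ <;> rw [h] <;>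
        linarith [Real.exp_pos s, Real.exp_pos (-s)]
    calc _ ≤ _ := h2
      _ = m.factorial * Real.exp |s| := mul_comm _ _
      _ ≤ _ := by gcongr
  simp only [norm_mul, norm_pow, Complex.norm_real, Real.norm_eq_abs, Complex.norm_exp, Pi.add_apply]
  have h2 : (-(c : ℂ) / 2 * s ^ 2 + (β + 1) * s).re = (-(c : ℂ) / 2 * s ^ 2 + β * s).re + s := by
    simp [add_mul]; ring
  have h3 : (-(c : ℂ) / 2 * s ^ 2 + (β - 1) * s).re = (-(c : ℂ) / 2 * s ^ 2 + β * s).re + -s := by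
    simp [sub_mul]; ring
  rw [h2, h3, Real.exp_add, Real.exp_add, ← mul_add, mul_left_comm, mul_comm]
  gcongr

/-- The moments of a complex Gaussian weight are the coefficients of `heatSeries`. -/
lemma integral_pow_mul_cexp {c : ℝ} (hc : 0 < c) (β : ℂ) (m : ℕ) :
    ∫ s : ℝ, (s : ℂ) ^ m * Complex.exp (-(c : ℂ) / 2 * s ^ 2 + β * s) =
      (√(2 * π / c) : ℝ) * Complex.exp (β ^ 2 / (2 * c)) *
        (m.factorial * PowerSeries.coeff m (heatSeries (β / c) (1 / c))) := by
  have hc' : (c : ℂ) ≠ 0 := by exact_mod_cast hc.ne'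
  set J : ℕ → ℂ := fun m => ∫ s : ℝ, (s : ℂ) ^ m * Complex.exp (-(c : ℂ) / 2 * s ^ 2 + β * s)
    with hJ
  have hder : ∀ s : ℝ, HasDerivAt
      (fun s : ℝ => Complex.exp (-(c : ℂ) / 2 * (s : ℂ) ^ 2 + β * s))
      (Complex.exp (-(c : ℂ) / 2 * (s : ℂ) ^ 2 + β * s) * (β - c * s)) s := by
    intro s
    have h1 : HasDerivAt (fun z : ℂ => Complex.exp (-(c : ℂ) / 2 * z ^ 2 + β * z))
        (Complex.exp (-(c : ℂ) / 2 * (s : ℂ) ^ 2 + β * s) *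
          (-(c : ℂ) / 2 * (2 * (s : ℂ)) + β)) s := by
      refine HasDerivAt.cexp (HasDerivAt.add ?_ ?_)
      · simpa using (hasDerivAt_pow 2 (s : ℂ)).const_mul (-(c : ℂ) / 2)
      · simpa using (hasDerivAt_id (s : ℂ)).const_mul β
    convert h1.comp_ofReal using 1
    ring
  have h0 : J 0 = (√(2 * π / c) : ℝ) * Complex.exp (β ^ 2 / (2 * c)) := by
    have := integral_cexp_quadratic (b := -(c : ℂ) / 2) (by simpa [neg_div] using hc) β 0
    simp only [hJ, pow_zero, one_mul]
    simp only [add_zero] at this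
    rw [this]
    congr 1
    · have h2 : (π : ℂ) / -(-(c : ℂ) / 2) = ((2 * π / c : ℝ) : ℂ) := by
        push_cast
        field_simp
      rw [h2, Real.sqrt_eq_rpow, Complex.ofReal_cpow (by positivity)]
      norm_num
    · congr 1
      field_simp
      ring
  have h1 : c * J 1 = β * J 0 := by
    have h := integral_eq_zero_of_hasDerivAt_of_integrable hder ?_ ?_
    · have h2 : ∀ s : ℝ, Complex.exp (-(c : ℂ) / 2 * (s : ℂ) ^ 2 + β * s) * (β - c * s) =
        β * ((s : ℂ) ^ 0 * Complex.exp (-(c : ℂ) / 2 * (s : ℂ) ^ 2 + β * s)) -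
        c * ((s : ℂ) ^ 1 * Complex.exp (-(c : ℂ) / 2 * (s : ℂ) ^ 2 + β * s)) := fun s => by ring
      simp_rw [h2] at h
      rw [integral_sub ((integrable_pow_mul_cexp hc β 0).const_mul _)
        ((integrable_pow_mul_cexp hc β 1).const_mul _), integral_const_mul,
        integral_const_mul] at h
      exact (sub_eq_zero.1 h).symm
    · refine (((integrable_pow_mul_cexp hc β 0).const_mul β).sub
        ((integrable_pow_mul_cexp hc β 1).const_mul (c : ℂ))).congr
        (Filter.Eventually.of_forall fun s => ?_)
      simp only [Pi.sub_apply]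
      ring
    · simpa using integrable_pow_mul_cexp hc β 0
  have hrec : ∀ m, c * J (m + 2) = β * J (m + 1) + (m + 1) * J m := by
    intro m
    have hd : ∀ s : ℝ, HasDerivAt
      (fun s : ℝ => (s : ℂ) ^ (m + 1) * Complex.exp (-(c : ℂ) / 2 * (s : ℂ) ^ 2 + β * s))
      (β * ((s : ℂ) ^ (m + 1) * Complex.exp (-(c : ℂ) / 2 * (s : ℂ) ^ 2 + β * s)) +
       (m + 1) * ((s : ℂ) ^ m * Complex.exp (-(c : ℂ) / 2 * (s : ℂ) ^ 2 + β * s)) -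
       c * ((s : ℂ) ^ (m + 2) * Complex.exp (-(c : ℂ) / 2 * (s : ℂ) ^ 2 + β * s))) s := by
      intro s
      have h2 : HasDerivAt (fun s : ℝ => (s : ℂ) ^ (m + 1)) ((m + 1) * (s : ℂ) ^ m) s := by
        simpa using (hasDerivAt_pow (m + 1) (s : ℂ)).comp_ofReal
      exact (h2.mul (hder s)).congr_deriv (by ring)
    have hint : ∀ m, Integrable fun s : ℝ =>
      (s : ℂ) ^ m * Complex.exp (-(c : ℂ) / 2 * (s : ℂ) ^ 2 + β * s) := fun m =>
      integrable_pow_mul_cexp hc β m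
    have hadd : Integrable fun s : ℝ =>
        β * ((s : ℂ) ^ (m + 1) * Complex.exp (-(c : ℂ) / 2 * (s : ℂ) ^ 2 + β * s)) +
        (m + 1) * ((s : ℂ) ^ m * Complex.exp (-(c : ℂ) / 2 * (s : ℂ) ^ 2 + β * s)) :=
      ((hint (m + 1)).const_mul β).add ((hint m).const_mul _)
    have h := integral_eq_zero_of_hasDerivAt_of_integrable hd
      (hadd.sub ((hint (m + 2)).const_mul _)) (hint (m + 1))
    rw [integral_sub hadd ((hint (m + 2)).const_mul _), integral_add ((hint (m + 1)).const_mul β)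
      ((hint m).const_mul _), integral_const_mul, integral_const_mul, integral_const_mul] at h
    exact (sub_eq_zero.1 h).symm
  have key : ∀ m, J m = J 0 *
      (m.factorial * PowerSeries.coeff m (heatSeries (β / c) (1 / c))) := by
    intro m
    induction m using Nat.twoStepInduction with
    | zero => simp [coeff_heatSeries_zero]
    | one =>
      rw [coeff_heatSeries_one]
      field_simp
      simpa [mul_comm] using h1
    | more m ih1 ih2 =>
      have h3 := coeff_heatSeries_add_two (β / (c : ℂ)) (1 / (c : ℂ)) m
      have h4 := hrec m
      rw [ih1, ih2] at h4
      refine mul_left_cancel₀ hc' ?_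
      rw [h4, Nat.factorial_succ (m + 1), Nat.factorial_succ m]
      push_cast
      have h5 : (c : ℂ) * (β / c) = β := by field_simp
      have h6 : (c : ℂ) * (1 / c) = 1 := by field_simp
      linear_combination (-(c : ℂ) * J 0 * (m + 1) * m.factorial) * h3 -
        (J 0 * (m + 1) * m.factorial) * (PowerSeries.coeff (m + 1) (heatSeries (β / c) (1 / c))) * h5
        - (J 0 * (m + 1) * m.factorial) * (PowerSeries.coeff m (heatSeries (β / c) (1 / c))) * h6
  rw [← h0]
  exact key m

/-- Integration of a Newton polynomial against a weight whose moments are known. -/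
lemma integral_mul_configProd {X : Type*} [MeasurableSpace X] {μ : Measure X} {g z : X → ℂ}
    {b : ℕ → ℂ} (hi : ∀ m, Integrable (fun s => g s * z s ^ m) μ)
    (hb : ∀ m, ∫ s, g s * z s ^ m ∂μ = b m) (ξ : Multiset ℝ) (n : ℕ) :
    ∫ s, g s * configProd (configTake ξ n) (z s) ∂μ =
      (newtonPoly ξ n).sum fun m c => c * b m := by
  have h : ∀ s, g s * configProd (configTake ξ n) (z s) =
      ∑ m ∈ (newtonPoly ξ n).support, (newtonPoly ξ n).coeff m * (g s * z s ^ m) := by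
    intro s
    rw [← newtonPoly_eval, Polynomial.eval_eq_sum, Polynomial.sum, Finset.mul_sum]
    exact Finset.sum_congr rfl fun m _ => by ring
  simp_rw [h]
  rw [integral_finsetSum _ fun m _ => (hi m).const_mul _]
  simp_rw [integral_const_mul, hb]
  rfl

/-! ### Triangular determinants and the configuration `N δ₀` -/

lemma det_lower_of_ite {N : ℕ} (d : ℕ → ℕ → ℂ) :
    (Matrix.of fun m n : Fin N => if (n : ℕ) ≤ m then d m n else 0).det = ∏ n : Fin N, d n n := by
  rw [Matrix.det_of_isLowerTriangular]
  · simp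
  · intro i j hij
    have : (i : ℕ) < j := hij
    exact if_neg (not_le.2 this)

lemma det_upper_of_ite {N : ℕ} (d : ℕ → ℕ → ℂ) :
    (Matrix.of fun n k : Fin N => if (n : ℕ) ≤ k then d n k else 0).det = ∏ n : Fin N, d n n := by
  rw [← Matrix.det_transpose, ← det_lower_of_ite fun m n => d n m]
  rfl

lemma card_configZero (N : ℕ) : (configZero N).card = N := by simp [configZero]

lemma configTake_configZero {N n : ℕ} (hn : n ≤ N) :
    configTake (configZero N) n = Multiset.replicate n 0 := by
  refine Multiset.eq_replicate.2 ⟨by simpa [configTake, card_configZero] using hn, ?_⟩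
  intro a ha
  exact Multiset.eq_of_mem_replicate (Multiset.mem_of_le (configTake_le _ _) ha)

lemma newtonPoly_configZero {N n : ℕ} (hn : n ≤ N) :
    newtonPoly (configZero N) n = Polynomial.X ^ n := by
  rw [newtonPoly, configTake_configZero hn]
  simp

/-! ### Noncolliding Brownian motion -/

lemma bmP_differentiable (t : ℝ) (y : ℂ) : Differentiable ℂ (bmP t y) := by
  unfold bmP
  fun_prop

lemma bmP_eq {t : ℝ} (ht : 0 < t) (y z : ℂ) :
    bmP t y z = bmP t y 0 * Complex.exp (y / t * z + -1 / t * z ^ 2 / 2) := by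
  have : (t : ℂ) ≠ 0 := by exact_mod_cast ht.ne'
  unfold bmP
  have h : Complex.exp (-(z - y) ^ 2 / (2 * t)) = Complex.exp (-(0 - y) ^ 2 / (2 * t)) *
      Complex.exp (y / t * z + -1 / t * z ^ 2 / 2) := by
    rw [← Complex.exp_add]
    congr 1
    field_simp
    ring
  rw [h]
  ring

lemma bmPhiPlus_configZero {N n : ℕ} (hn : n < N) {t : ℝ} (ht : 0 < t) (y : ℂ) :
    bmPhiPlus n t y (configZero N) =
      bmP t y 0 * PowerSeries.coeff n (heatSeries (y / t) (-1 / t)) := by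
  unfold bmPhiPlus
  rw [configTake_configZero hn]
  refine contourAround_replicate_zero (bmP_differentiable t y)
    (c := fun n => bmP t y 0 * PowerSeries.coeff n (heatSeries (y / t) (-1 / t))) (fun z => ?_) n
  rw [bmP_eq ht y z]
  simpa only [mul_assoc] using (absSumsTo_heatSeries (y / t) (-1 / t) z).2.mul_left (bmP t y 0)

/-- The moments of `p(-t, i s | y)`: monomials evolved by the backward heat equation. -/
lemma bmP_neg_moment {t : ℝ} (ht : 0 < t) (y : ℂ) (m : ℕ) :
    Integrable (fun s : ℝ => bmP (-t) (Complex.I * s) y * (Complex.I * s) ^ m) ∧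
    ∫ s : ℝ, bmP (-t) (Complex.I * s) y * (Complex.I * s) ^ m =
      m.factorial * PowerSeries.coeff m (heatSeries y (-t)) := by
  have ht' : (t : ℂ) ≠ 0 := by exact_mod_cast ht.ne'
  have h : ∀ s : ℝ, bmP (-t) (Complex.I * s) y * (Complex.I * s) ^ m =
      (1 / (√(2 * π * t) : ℝ) * Complex.exp (y ^ 2 / (2 * t)) * Complex.I ^ m) *
      ((s : ℂ) ^ m * Complex.exp (-((1 / t : ℝ) : ℂ) / 2 * s ^ 2 + (-Complex.I * y / t) * s)) := by
    intro s
    unfold bmP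
    have h1 : Complex.exp (-(y - Complex.I * s) ^ 2 / (2 * ((-t : ℝ) : ℂ))) =
        Complex.exp (y ^ 2 / (2 * t)) *
        Complex.exp (-((1 / t : ℝ) : ℂ) / 2 * s ^ 2 + (-Complex.I * y / t) * s) := by
      rw [← Complex.exp_add]
      congr 1
      push_cast
      field_simp
      linear_combination (s : ℂ) ^ 2 * Complex.I_sq
    rw [h1, abs_neg, abs_of_pos ht]
    ring
  simp_rw [h]
  refine ⟨(integrable_pow_mul_cexp (by positivity) _ m).const_mul _, ?_⟩
  rw [integral_const_mul, integral_pow_mul_cexp (by positivity)]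
  have h1 : -Complex.I * y / t / ((1 / t : ℝ) : ℂ) = -Complex.I * y := by
    push_cast
    field_simp
  have h2 : 1 / ((1 / t : ℝ) : ℂ) = t := by push_cast; field_simp
  have h3 : (-Complex.I * y / t) ^ 2 / (2 * ((1 / t : ℝ) : ℂ)) = -(y ^ 2 / (2 * t)) := by
    push_cast
    field_simp
    linear_combination y ^ 2 * Complex.I_sq
  have h4 : 2 * π / (1 / t) = 2 * π * t := by field_simp
  have h5 : Complex.I ^ m * PowerSeries.coeff m (heatSeries (-Complex.I * y) (t : ℂ)) =
      PowerSeries.coeff m (heatSeries y (-t : ℂ)) := by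
    rw [← PowerSeries.coeff_rescale, rescale_heatSeries]
    congr 3
    · linear_combination -y * Complex.I_sq
    · rw [Complex.I_sq]; ring
  have h6 : ((√(2 * π * t) : ℝ) : ℂ) ≠ 0 := by
    have : 0 < √(2 * π * t) := by positivity
    exact_mod_cast this.ne'
  rw [h1, h2, h3, h4, ← h5, Complex.exp_neg]
  have h7 := Complex.exp_ne_zero (y ^ 2 / (2 * t))
  field_simp

lemma bmPhiMinus_eq {t : ℝ} (ht : 0 < t) (y : ℂ) (ξ : Multiset ℝ) (n : ℕ) :
    bmPhiMinus n t y ξ = (newtonPoly ξ n).sum fun m c =>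
      c * (m.factorial * PowerSeries.coeff m (heatSeries y (-t))) :=
  integral_mul_configProd (fun m => (bmP_neg_moment ht y m).1)
    (fun m => (bmP_neg_moment ht y m).2) ξ n

/-- The heat kernel integrated against `a ^ k` times a centred Gaussian. -/
lemma integral_bmP_mul_pow {t v : ℝ} (ht : 0 < t) (hv : 0 < v) (y : ℂ) (k : ℕ) :
    Integrable (fun a : ℝ => bmP t y a * ((a : ℂ) ^ k * (Real.exp (-a ^ 2 / (2 * v)) : ℝ))) ∧
    ∫ a : ℝ, bmP t y a * ((a : ℂ) ^ k * (Real.exp (-a ^ 2 / (2 * v)) : ℝ)) =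
      (√(2 * π * v) : ℝ) * bmP (t + v) y 0 * (k.factorial *
        PowerSeries.coeff k (heatSeries (y * v / (t + v)) (t * v / (t + v)))) := by
  have ht' : (t : ℂ) ≠ 0 := by exact_mod_cast ht.ne'
  have hv' : (v : ℂ) ≠ 0 := by exact_mod_cast hv.ne'
  have htv : (t + v : ℂ) ≠ 0 := by exact_mod_cast (add_pos ht hv).ne'
  have hc : 0 < 1 / t + 1 / v := by positivity
  have h : ∀ a : ℝ, bmP t y a * ((a : ℂ) ^ k * (Real.exp (-a ^ 2 / (2 * v)) : ℝ)) =
      (1 / (√(2 * π * t) : ℝ) * Complex.exp (-y ^ 2 / (2 * t))) *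
      ((a : ℂ) ^ k * Complex.exp (-((1 / t + 1 / v : ℝ) : ℂ) / 2 * a ^ 2 + (y / t) * a)) := by
    intro a
    unfold bmP
    have h1 : Complex.exp (-(a - y) ^ 2 / (2 * t)) * ((Real.exp (-a ^ 2 / (2 * v)) : ℝ) : ℂ) =
        Complex.exp (-y ^ 2 / (2 * t)) *
        Complex.exp (-((1 / t + 1 / v : ℝ) : ℂ) / 2 * a ^ 2 + (y / t) * a) := by
      rw [Complex.ofReal_exp, ← Complex.exp_add, ← Complex.exp_add]
      congr 1
      push_cast
      field_simp
      ring
    rw [abs_of_pos ht]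
    linear_combination (1 / ((√(2 * π * t) : ℝ) : ℂ) * (a : ℂ) ^ k) * h1
  simp_rw [h]
  refine ⟨(integrable_pow_mul_cexp hc _ k).const_mul _, ?_⟩
  rw [integral_const_mul, integral_pow_mul_cexp hc]
  have hcc : ((1 / t + 1 / v : ℝ) : ℂ) = (t + v) / (t * v) := by
    push_cast; field_simp; ring
  have h1 : y / t / ((1 / t + 1 / v : ℝ) : ℂ) = y * v / (t + v) := by
    rw [hcc]; field_simp
  have h2 : 1 / ((1 / t + 1 / v : ℝ) : ℂ) = t * v / (t + v) := by rw [hcc]; field_simp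
  have h3 : Complex.exp (-y ^ 2 / (2 * t)) *
      Complex.exp ((y / t) ^ 2 / (2 * ((1 / t + 1 / v : ℝ) : ℂ))) =
      Complex.exp (-(0 - y) ^ 2 / (2 * ((t + v : ℝ) : ℂ))) := by
    rw [hcc, ← Complex.exp_add]
    congr 1
    push_cast
    field_simp
    ring
  have h4 : (1 / (√(2 * π * t) : ℝ) : ℂ) * (√(2 * π / (1 / t + 1 / v)) : ℝ) =
      (√(2 * π * v) : ℝ) * (1 / (√(2 * π * (t + v)) : ℝ)) := by
    norm_cast
    have e1 : 2 * π / (1 / t + 1 / v) = (2 * π * t) * (2 * π * v) / (2 * π * (t + v)) := by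
      field_simp; ring
    rw [e1, Real.sqrt_div (by positivity), Real.sqrt_mul (by positivity : 0 ≤ 2 * π * t) (2 * π * v)]
    have : √(2 * π * t) ≠ 0 := (by positivity : 0 < √(2 * π * t)).ne'
    generalize √(2 * π * t) = A at this ⊢
    field_simp
  rw [h1, h2]
  unfold bmP
  rw [abs_of_pos (add_pos ht hv), ← h3]
  linear_combination (Complex.exp (-y ^ 2 / (2 * t)) *
      Complex.exp ((y / t) ^ 2 / (2 * ((1 / t + 1 / v : ℝ) : ℂ))) * (k.factorial *
        PowerSeries.coeff k (heatSeries (y * v / (t + v)) (t * v / (t + v))))) * h4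

/-! ### Averaging over the GUE -/

lemma heatSeries_zero_left (v : ℂ) : heatSeries 0 v = gaussSeries v := by
  simp [heatSeries]

/-- The normalizing constant of the GUE. -/
lemma prod_factorial_mul_sqrt {σ : ℝ} (hσ : 0 < σ) (N : ℕ) :
    ∏ k ∈ Finset.range N, ((k.factorial : ℝ) * √(2 * π * σ ^ 2) * (σ ^ 2) ^ k) =
      σ ^ N ^ 2 * ((2 * π) ^ (N / 2 : ℝ) * ∏ j ∈ Finset.Icc 1 N, Real.Gamma j) := by
  induction N with
  | zero => simp
  | succ N ih =>
    rw [Finset.prod_range_succ, ih, Finset.prod_Icc_succ_top (by omega)]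
    have h1 : Real.Gamma ((N + 1 : ℕ) : ℝ) = N.factorial := by
      push_cast
      exact Real.Gamma_nat_eq_factorial N
    have h2 : √(2 * π * σ ^ 2) = √(2 * π) * σ := by
      rw [Real.sqrt_mul (by positivity), Real.sqrt_sq hσ.le]
    have h3 : (2 * π) ^ (((N + 1 : ℕ) : ℝ) / 2) = (2 * π) ^ (N / 2 : ℝ) * √(2 * π) := by
      rw [Real.sqrt_eq_rpow, ← Real.rpow_add (by positivity)]
      congr 1
      push_cast
      ring
    rw [h1, h2, h3]
    ring

/-- The invariance of the determinants under randomization of the initial configuration, for the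
noncolliding Brownian motion observed at finitely many space-time points. -/
theorem gueExpect_det_bmKernel (N : ℕ) {σ : ℝ} (hσ : 0 < σ) {ι : Type*} [Fintype ι] [DecidableEq ι]
    (t x : ι → ℝ) (ht : ∀ p, 0 < t p) :
    GueIntegrable N σ
      (fun ξ => (Matrix.of fun p q => bmKernel ξ (t p) (x p) (t q) (x q)).det) ∧
    gueExpect N σ (fun ξ => (Matrix.of fun p q => bmKernel ξ (t p) (x p) (t q) (x q)).det) =
      (Matrix.of fun p q =>
        bmKernel (configZero N) (t p + σ ^ 2) (x p) (t q + σ ^ 2) (x q)).det := by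
  have hv : 0 < σ ^ 2 := by positivity
  have ht2 : ∀ p, 0 < t p + σ ^ 2 := fun p => add_pos (ht p) hv
  set v : ℂ := ((σ ^ 2 : ℝ) : ℂ) with hvdef
  let w : ℝ → ℂ := fun a => (Real.exp (-a ^ 2 / (2 * σ ^ 2)) : ℝ)
  let Z : ℂ := (((σ ^ N ^ 2)⁻¹ /
    ((2 * π) ^ (N / 2 : ℝ) * ∏ j ∈ Finset.Icc 1 N, Real.Gamma j) : ℝ) : ℂ)
  let κ : ℂ := (√(2 * π * σ ^ 2) : ℝ)
  let e : ℕ → ℂ := fun n => PowerSeries.coeff n (gaussSeries v)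
  let b : ι → ℕ → ℂ := fun q m =>
    m.factorial * PowerSeries.coeff m (heatSeries (x q : ℂ) (-(t q : ℂ)))
  let P : ι → ι → ℂ := fun p q => if t q < t p then bmP (t p - t q) (x p) (x q) else 0
  let C : Matrix ι (Fin N) ℂ := Matrix.of fun p n => bmP (t p + σ ^ 2) (x p) 0 *
    PowerSeries.coeff n (heatSeries ((x p : ℂ) / ((t p + σ ^ 2 : ℝ) : ℂ))
      (-1 / ((t p + σ ^ 2 : ℝ) : ℂ)))
  let B : Matrix (Fin N) ι ℂ := Matrix.of fun m q => (m : ℕ).factorial *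
    PowerSeries.coeff m (heatSeries (x q : ℂ) (-((t q + σ ^ 2 : ℝ) : ℂ)))
  let D : Matrix (Fin N) (Fin N) ℂ := Matrix.of fun m n => if (n : ℕ) ≤ m then
    (m : ℕ).factorial / (n : ℕ).factorial * e (m - n) else 0
  let T : Matrix (Fin N) (Fin N) ℂ := Matrix.of fun n k => if (n : ℕ) ≤ k then
    (k : ℕ).factorial * κ * v ^ (n : ℕ) * e (k - n) else 0
  have hmain := expect_det (N := N) w Z (fun p => bmP (t p) (x p))
    (fun p => bmP_differentiable _ _) b P ?_ (fun p k => (integral_bmP_mul_pow (ht p) hv _ k).1)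
    D T C B ?_ ?_ ?_ ?_ (fun ξ p q => bmKernel ξ (t p) (x p) (t q) (x q)) ?_
  · have hRHS : (Matrix.of fun p q =>
        bmKernel (configZero N) (t p + σ ^ 2) (x p) (t q + σ ^ 2) (x q)) = C * B - Matrix.of P := by
      ext p q
      rw [Matrix.sub_apply, Matrix.mul_apply, Matrix.of_apply, bmKernel, card_configZero,
        Finset.sum_range]
      congr 1
      · refine Finset.sum_congr rfl fun n _ => ?_
        rw [bmPhiPlus_configZero n.2 (ht2 p), bmPhiMinus_eq (ht2 q),
          newtonPoly_configZero n.2.le, ← Polynomial.monomial_one_right_eq_X_pow,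
          Polynomial.sum_monomial_index _ _ (by simp), one_mul]
        rfl
      · simp [P]
    have hdens : ∀ a : Fin N → ℝ, ((gueDensity N σ a : ℝ) : ℂ) =
        Z * (∏ k, w (a k)) * (hProd a : ℂ) ^ 2 := by
      intro a
      have h1 : ∏ k, Real.exp (-a k ^ 2 / (2 * σ ^ 2)) =
          Real.exp (-(∑ j, a j ^ 2) / (2 * σ ^ 2)) := by
        rw [← Real.exp_sum, neg_div, Finset.sum_div, ← Finset.sum_neg_distrib]
        simp only [neg_div]
      simp only [gueDensity, Z, w, ← h1]
      push_cast
      ring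
    unfold GueIntegrable gueExpect
    rw [hRHS]
    simp_rw [hdens]
    exact hmain
  · intro k
    have := integrable_pow_mul_cexp (c := 1 / σ ^ 2) (by positivity) 0 k
    refine this.congr (Filter.Eventually.of_forall fun a => ?_)
    simp only [w]
    push_cast
    congr 2
    field_simp
    ring
  · intro m k
    have h1 := integral_pow_mul_cexp (c := 1 / σ ^ 2) (by positivity) 0 (m + k : ℕ)
    have h2 : 1 / ((1 / σ ^ 2 : ℝ) : ℂ) = v := by simp [hvdef]
    have h3 : 2 * π / (1 / σ ^ 2) = 2 * π * σ ^ 2 := by field_simp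
    rw [zero_div, h2, h3, heatSeries_zero_left, zero_pow two_ne_zero, zero_div, Complex.exp_zero,
      mul_one, ← wick] at h1
    have h4 : ∀ a : ℝ, (a : ℂ) ^ (m + k : ℕ) * w a = (a : ℂ) ^ (m + k : ℕ) *
        Complex.exp (-((1 / σ ^ 2 : ℝ) : ℂ) / 2 * a ^ 2 + 0 * a) := by
      intro a
      simp only [w]
      push_cast
      congr 2
      field_simp
      ring
    simp_rw [h4]
    rw [h1, Matrix.mul_apply]
    have h5 := sum_fin_toeplitz k.2 e fun n => (if n ≤ m then e (m - n) * (v ^ n *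
      algebraMap ℚ ℂ (1 / n.factorial)) else 0)
    rw [← h5, ← mul_assoc, Finset.mul_sum]
    refine Finset.sum_congr rfl fun n _ => ?_
    simp only [D, T, Matrix.of_apply]
    by_cases hm : (n : ℕ) ≤ m
    · by_cases hk : (n : ℕ) ≤ k
      · simp only [hm, hk, if_true, κ]
        rw [eq_ratCast]
        push_cast
        ring
      · simp [hk]
    · simp [hm]
  · intro p k
    have htp : (t p : ℂ) + v ≠ 0 := by
      rw [hvdef]
      exact_mod_cast (ht2 p).ne'
    have h1 := (integral_bmP_mul_pow (ht p) hv (x p) k).2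
    have h2 : heatSeries ((x p : ℂ) * v / (t p + v)) (t p * v / (t p + v)) =
        gaussSeries v * PowerSeries.rescale v (heatSeries ((x p : ℂ) / ((t p + σ ^ 2 : ℝ) : ℂ))
          (-1 / ((t p + σ ^ 2 : ℝ) : ℂ))) := by
      rw [rescale_heatSeries, ← heatSeries_add_right, Complex.ofReal_add, ← hvdef]
      congr 1
      · ring
      · field_simp
        ring
    rw [h1, ← hvdef, h2, PowerSeries.coeff_mul, Matrix.mul_apply]
    simp only [PowerSeries.coeff_rescale]
    rw [← sum_fin_toeplitz k.2 e fun n => v ^ n * PowerSeries.coeff n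
      (heatSeries ((x p : ℂ) / ((t p + σ ^ 2 : ℝ) : ℂ)) (-1 / ((t p + σ ^ 2 : ℝ) : ℂ))),
      Finset.mul_sum, Finset.mul_sum]
    refine Finset.sum_congr rfl fun n _ => ?_
    simp only [C, T, Matrix.of_apply, κ]
    split_ifs
    · ring
    · simp
  · intro m q
    have h1 : (-(t q : ℂ)) = v + -((t q + σ ^ 2 : ℝ) : ℂ) := by
      rw [hvdef]
      push_cast
      ring
    simp only [b]
    rw [h1, heatSeries_add_right, PowerSeries.coeff_mul, Matrix.mul_apply]
    rw [← sum_fin_toeplitz m.2 e fun n => PowerSeries.coeff n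
      (heatSeries (x q : ℂ) (-((t q + σ ^ 2 : ℝ) : ℂ))), Finset.mul_sum]
    refine Finset.sum_congr rfl fun n _ => ?_
    have h2 : (((n : ℕ).factorial : ℕ) : ℂ) ≠ 0 := by exact_mod_cast (n : ℕ).factorial_ne_zero
    simp only [D, B, Matrix.of_apply]
    split_ifs
    · field_simp
    · simp
  · have hD : D.det = 1 := by
      rw [det_lower_of_ite fun m n => (m.factorial / n.factorial * e (m - n) : ℂ)]
      refine Finset.prod_eq_one fun n _ => ?_
      have h2 : (((n : ℕ).factorial : ℕ) : ℂ) ≠ 0 := by exact_mod_cast (n : ℕ).factorial_ne_zero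
      simp [e, coeff_gaussSeries_zero, h2]
    have hT : T.det = ((∏ k ∈ Finset.range N,
        ((k.factorial : ℝ) * √(2 * π * σ ^ 2) * (σ ^ 2) ^ k) : ℝ) : ℂ) := by
      rw [det_upper_of_ite fun n k => (k.factorial * κ * v ^ n * e (k - n) : ℂ), Finset.prod_range]
      simp [e, coeff_gaussSeries_zero, κ, v]
    rw [hD, hT, one_mul, prod_factorial_mul_sqrt hσ]
    simp only [Z]
    norm_cast
    have h1 : ∏ j ∈ Finset.Icc 1 N, Real.Gamma j ≠ 0 := by
      refine Finset.prod_ne_zero_iff.2 fun j hj => (Real.Gamma_pos_of_pos ?_).ne'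
      have := (Finset.mem_Icc.1 hj).1
      exact_mod_cast this
    have h2 : (2 * π) ^ (N / 2 : ℝ) ≠ 0 := (Real.rpow_pos_of_pos (by positivity) _).ne'
    field_simp
  · intro ξ p q
    rw [bmKernel]
    congr 1
    refine Finset.sum_congr rfl fun n _ => ?_
    rw [bmPhiMinus_eq (ht q)]
    rfl

/-! ### The Bessel series -/

/-- The constants `κ_n = n! Γ(n + ν + 1)`. -/
noncomputable def besselFactor (ν : ℝ) (n : ℕ) : ℝ := n.factorial * Real.Gamma (n + ν + 1)

lemma besselFactor_pos {ν : ℝ} (hν : -1 < ν) (n : ℕ) : 0 < besselFactor ν n := by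
  have h : 0 < (n : ℝ) + ν + 1 := by linarith [(Nat.cast_nonneg n : (0 : ℝ) ≤ n)]
  exact mul_pos (by positivity) (Real.Gamma_pos_of_pos h)

lemma besselFactor_ne_zero {ν : ℝ} (hν : -1 < ν) (n : ℕ) : (besselFactor ν n : ℂ) ≠ 0 := by
  exact_mod_cast (besselFactor_pos hν n).ne'

lemma Gamma_nat_add_succ {ν : ℝ} (hν : -1 < ν) (n : ℕ) :
    Real.Gamma ((n + 1 : ℕ) + ν + 1) = (n + ν + 1) * Real.Gamma (n + ν + 1) := by
  have h : (n : ℝ) + ν + 1 ≠ 0 := by linarith [(Nat.cast_nonneg n : (0 : ℝ) ≤ n)]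
  rw [← Real.Gamma_add_one h]
  congr 1
  push_cast
  ring

lemma besselFactor_succ {ν : ℝ} (hν : -1 < ν) (n : ℕ) :
    besselFactor ν (n + 1) = (n + 1) * (n + ν + 1) * besselFactor ν n := by
  unfold besselFactor
  rw [Gamma_nat_add_succ hν, Nat.factorial_succ]
  push_cast
  ring

/-- The power series `∑ Xⁿ / (n! Γ(n + ν + 1))`. -/
noncomputable def besselSeries (ν : ℝ) : PowerSeries ℂ :=
  PowerSeries.mk fun n => 1 / (besselFactor ν n : ℂ)

/-- The entire function `∑ uⁿ / (n! Γ(n + ν + 1))`, which is `(w / 2)^(-ν) I_ν(w)` at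
`u = w² / 4`. -/
noncomputable def besselPhi (ν : ℝ) (u : ℂ) : ℂ := ∑' n : ℕ, u ^ n / (besselFactor ν n : ℂ)

/-- The power series `exp (A X) ∑ (B X)ⁿ / (n! Γ(n + ν + 1))`, a generating function of Laguerre
polynomials. -/
noncomputable def laguerreSeries (ν : ℝ) (A B : ℂ) : PowerSeries ℂ :=
  PowerSeries.rescale A (PowerSeries.exp ℂ) * PowerSeries.rescale B (besselSeries ν)

lemma laguerreSeries_add (ν : ℝ) (A A' B : ℂ) : laguerreSeries ν (A + A') B =
    PowerSeries.rescale A (PowerSeries.exp ℂ) * laguerreSeries ν A' B := by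
  unfold laguerreSeries
  rw [← PowerSeries.exp_mul_exp_eq_exp_add, mul_assoc]

lemma rescale_laguerreSeries (ν : ℝ) (ρ A B : ℂ) :
    PowerSeries.rescale ρ (laguerreSeries ν A B) = laguerreSeries ν (ρ * A) (ρ * B) := by
  unfold laguerreSeries
  rw [map_mul, PowerSeries.rescale_rescale, PowerSeries.rescale_rescale, mul_comm A, mul_comm B]

lemma summable_norm_besselPhi {ν : ℝ} (hν : -1 < ν) (u : ℂ) :
    Summable fun n : ℕ => ‖u ^ n / (besselFactor ν n : ℂ)‖ := by
  refine Summable.of_norm_bounded_eventually_nat (g := fun n => ‖u ^ n / (n.factorial : ℂ)‖)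
    (NormedSpace.norm_expSeries_div_summable u) ?_
  filter_upwards [Filter.eventually_ge_atTop 2] with n hn
  have hn' : (2 : ℝ) ≤ n := by exact_mod_cast hn
  have hG : 1 ≤ Real.Gamma (n + ν + 1) := by
    have h := Real.Gamma_strictMonoOn_Ici.monotoneOn (a := 2) (b := n + ν + 1) (by simp)
      (by simp only [Set.mem_Ici]; linarith) (by linarith)
    rwa [Real.Gamma_two] at h
  rw [norm_norm, norm_div, norm_div, Complex.norm_real, Complex.norm_natCast,
    Real.norm_of_nonneg (besselFactor_pos hν n).le]
  refine div_le_div_of_nonneg_left (norm_nonneg _) (by positivity) ?_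
  exact le_mul_of_one_le_right (by positivity) hG

lemma absSumsTo_besselSeries {ν : ℝ} (hν : -1 < ν) (B z : ℂ) :
    (PowerSeries.rescale B (besselSeries ν)).AbsSumsTo z (besselPhi ν (B * z)) := by
  have h : ∀ n, PowerSeries.coeff n (PowerSeries.rescale B (besselSeries ν)) * z ^ n =
      (B * z) ^ n / (besselFactor ν n : ℂ) := by
    intro n
    rw [PowerSeries.coeff_rescale, besselSeries, PowerSeries.coeff_mk, mul_pow]
    ring
  unfold PowerSeries.AbsSumsTo
  simp_rw [h]
  exact ⟨summable_norm_besselPhi hν _, (summable_norm_besselPhi hν _).of_norm.hasSum⟩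

lemma absSumsTo_laguerreSeries {ν : ℝ} (hν : -1 < ν) (A B z : ℂ) :
    (laguerreSeries ν A B).AbsSumsTo z (Complex.exp (A * z) * besselPhi ν (B * z)) :=
  (absSumsTo_rescale_exp A z).mul (absSumsTo_besselSeries hν B z)

lemma besselPhi_differentiable {ν : ℝ} (hν : -1 < ν) : Differentiable ℂ (besselPhi ν) := by
  intro u
  have hs := summable_norm_besselPhi hν (((‖u‖ + 1 : ℝ)) : ℂ)
  have h : DifferentiableOn ℂ (besselPhi ν) (Metric.ball 0 (‖u‖ + 1)) := by
    refine Complex.differentiableOn_tsum_of_summable_norm hs (fun n => by fun_prop)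
      Metric.isOpen_ball fun n w hw => ?_
    have hu : ‖((‖u‖ + 1 : ℝ) : ℂ)‖ = ‖u‖ + 1 := by
      rw [Complex.norm_real, Real.norm_of_nonneg (by positivity)]
    rw [norm_div, norm_div, norm_pow, norm_pow, hu]
    gcongr
    exact (mem_ball_zero_iff.1 hw).le
  exact h.differentiableAt (Metric.isOpen_ball.mem_nhds (by simp))

lemma besselPhi_zero (ν : ℝ) : besselPhi ν 0 = 1 / (Real.Gamma (ν + 1) : ℂ) := by
  unfold besselPhi
  rw [tsum_eq_single 0 (fun n hn => by simp [hn])]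
  simp [besselFactor]

/-- The coefficients of the Kummer polynomials `∑ Yˡ / ((m - l)! κ_l)`. -/
noncomputable def kummerCoeff (ν : ℝ) (m l : ℕ) : ℂ :=
  if l ≤ m then 1 / ((m - l).factorial * (besselFactor ν l : ℂ)) else 0

/-- The Chu–Vandermonde identity, in the form of Kummer's transformation. -/
lemma exp_mul_kummer {ν : ℝ} (hν : -1 < ν) (m : ℕ) :
    PowerSeries.exp ℂ * PowerSeries.mk (kummerCoeff ν m) = PowerSeries.mk fun j =>
      (Real.Gamma ((j + m : ℕ) + ν + 1) : ℂ) / (besselFactor ν j * besselFactor ν m) := by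
  induction m with
  | zero =>
    ext j
    have h : PowerSeries.mk (kummerCoeff ν 0) = PowerSeries.C (1 / (besselFactor ν 0 : ℂ)) := by
      ext l
      rw [PowerSeries.coeff_mk, PowerSeries.coeff_C, kummerCoeff]
      rcases l with _ | l <;> simp
    have h1 := besselFactor_ne_zero hν j
    have h0 := besselFactor_ne_zero hν 0
    rw [h, mul_comm, PowerSeries.coeff_C_mul, PowerSeries.coeff_mk, PowerSeries.coeff_exp]
    have h3 : (besselFactor ν j : ℂ) = j.factorial * (Real.Gamma (j + ν + 1) : ℂ) := by
      simp [besselFactor]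
    have h4 := (right_ne_zero_of_mul (h3 ▸ h1))
    rw [h3, add_zero, eq_ratCast]
    push_cast
    have h5 : ((j.factorial : ℕ) : ℂ) ≠ 0 := by exact_mod_cast j.factorial_ne_zero
    field_simp
  | succ m ih =>
    -- `(m + 1) (m + 1 + ν) p_{m+1} = (m + ν + 1) p_m + Y p_m + Y p_m'` for the Kummer polynomials
    have hm1 : ((m : ℂ) + 1) * (m + ν + 1) ≠ 0 := by
      have : ((m : ℝ) + 1) * (m + ν + 1) ≠ 0 := by
        have : (0 : ℝ) ≤ m := Nat.cast_nonneg m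
        exact (mul_pos (by linarith) (by linarith)).ne'
      exact_mod_cast this
    have hrec : PowerSeries.C (((m : ℂ) + 1) * (m + ν + 1)) * PowerSeries.mk (kummerCoeff ν (m + 1)) =
        PowerSeries.C ((m : ℂ) + ν + 1) * PowerSeries.mk (kummerCoeff ν m) +
        PowerSeries.X * (PowerSeries.mk (kummerCoeff ν m) +
          PowerSeries.derivative ℂ (PowerSeries.mk (kummerCoeff ν m))) := by
      ext l
      rw [PowerSeries.coeff_C_mul, map_add, PowerSeries.coeff_C_mul]
      rcases l with _ | l
      · rw [PowerSeries.coeff_zero_X_mul]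
        simp only [PowerSeries.coeff_mk, kummerCoeff, Nat.zero_le, if_true, Nat.sub_zero,
          Nat.factorial_succ]
        have h0 := besselFactor_ne_zero hν 0
        have h1 : ((m.factorial : ℕ) : ℂ) ≠ 0 := by exact_mod_cast m.factorial_ne_zero
        have h2 : ((m : ℂ) + 1) ≠ 0 := left_ne_zero_of_mul hm1
        push_cast
        field_simp
        ring
      · rw [PowerSeries.coeff_succ_X_mul, map_add, PowerSeries.coeff_derivative]
        simp only [PowerSeries.coeff_mk, kummerCoeff]
        have hl := besselFactor_ne_zero hν l
        have hl1 := besselFactor_ne_zero hν (l + 1)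
        rw [besselFactor_succ hν l] at hl1 ⊢
        push_cast at hl1 ⊢
        have hl2 := left_ne_zero_of_mul (left_ne_zero_of_mul hl1)
        have hl3 := right_ne_zero_of_mul (left_ne_zero_of_mul hl1)
        rcases lt_trichotomy l m with h | h | h
        · obtain ⟨d, rfl⟩ := Nat.exists_eq_add_of_lt h
          have e2 : l + d + 1 - (l + 1) = d := by omega
          have e3 : l + d + 1 - l = d + 1 := by omega
          rw [if_pos (by omega), if_pos (by omega), if_pos (by omega), e2, e3,
            Nat.factorial_succ]
          have hd1 : ((d.factorial : ℕ) : ℂ) ≠ 0 := by exact_mod_cast d.factorial_ne_zero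
          have hd2 : ((d : ℂ) + 1) ≠ 0 := by exact_mod_cast d.succ_ne_zero
          push_cast
          field_simp
          ring
        · subst h
          rw [if_pos (by omega), if_neg (by omega), if_pos le_rfl]
          simp only [Nat.sub_self, Nat.factorial_zero]
          push_cast
          field_simp
          ring
        · rw [if_neg (by omega), if_neg (by omega), if_neg (by omega)]
          ring
    have hE := PowerSeries.derivative_exp ℂ
    have hd := congrArg (PowerSeries.derivative ℂ) ih
    rw [Derivation.leibniz, hE] at hd
    simp only [smul_eq_mul] at hd
    have h2 : PowerSeries.C (((m : ℂ) + 1) * (m + ν + 1)) *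
        (PowerSeries.exp ℂ * PowerSeries.mk (kummerCoeff ν (m + 1))) =
        PowerSeries.C ((m : ℂ) + ν + 1) * (PowerSeries.exp ℂ * PowerSeries.mk (kummerCoeff ν m)) +
        PowerSeries.X * PowerSeries.derivative ℂ
          (PowerSeries.exp ℂ * PowerSeries.mk (kummerCoeff ν m)) := by
      rw [Derivation.leibniz, hE]
      simp only [smul_eq_mul]
      linear_combination PowerSeries.exp ℂ * hrec
    rw [ih] at h2
    ext j
    have h3 := congrArg (PowerSeries.coeff j) h2
    rw [PowerSeries.coeff_C_mul] at h3
    refine mul_left_cancel₀ hm1 (h3.trans ?_)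
    have hj := besselFactor_ne_zero hν j
    have hm := besselFactor_ne_zero hν m
    have hκ := besselFactor_succ hν m
    have hΓ := Gamma_nat_add_succ hν (j + m)
    have hX : ∀ f : ℕ → ℂ, PowerSeries.coeff j (PowerSeries.X *
        PowerSeries.derivative ℂ (PowerSeries.mk f)) = j * f j := by
      intro f
      rcases j with _ | j
      · simp
      · rw [PowerSeries.coeff_succ_X_mul, PowerSeries.coeff_derivative, PowerSeries.coeff_mk]
        push_cast
        ring
    rw [map_add, PowerSeries.coeff_C_mul, hX, PowerSeries.coeff_mk, PowerSeries.coeff_mk,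
      ← add_assoc j m 1, hΓ, hκ]
    have hm2 := left_ne_zero_of_mul hm1
    have hm3 := right_ne_zero_of_mul hm1
    push_cast
    field_simp
    ring

/-! ### Integrals of the Bessel series -/

/-- Termwise integration of a series, together with the integrability of its sum. -/
lemma integrable_and_hasSum_integral {X : Type*} [MeasurableSpace X] {μ : Measure X}
    {F : ℕ → X → ℂ} {f : X → ℂ} (hf : AEStronglyMeasurable f μ) (hi : ∀ i, Integrable (F i) μ)
    (hs : Summable fun i => ∫ a, ‖F i a‖ ∂μ) (h : ∀ᵐ a ∂μ, HasSum (fun i => F i a) (f a)) :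
    Integrable f μ ∧ HasSum (fun i => ∫ a, F i a ∂μ) (∫ a, f a ∂μ) := by
  constructor
  · refine ⟨hf, ?_⟩
    have h1 : ∫⁻ a, ‖f a‖ₑ ∂μ ≤ ∫⁻ a, ∑' i, ‖F i a‖ₑ ∂μ := by
      refine lintegral_mono_ae ?_
      filter_upwards [h] with a ha
      rw [← ha.tsum_eq]
      exact enorm_tsum_le_tsum_enorm
    refine lt_of_le_of_lt h1 ?_
    rw [lintegral_tsum fun i => (hi i).1.enorm]
    have h2 : ∀ i, ∫⁻ a, ‖F i a‖ₑ ∂μ = ENNReal.ofReal (∫ a, ‖F i a‖ ∂μ) := fun i =>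
      (ofReal_integral_norm_eq_lintegral_enorm (hi i)).symm
    simp_rw [h2]
    exact hs.tsum_ofReal_lt_top
  · have h3 := hasSum_integral_of_summable_integral_norm hi hs
    have h4 : ∫ a, ∑' i, F i a ∂μ = ∫ a, f a ∂μ := by
      refine integral_congr_ae ?_
      filter_upwards [h] with a ha using ha.tsum_eq
    rwa [h4] at h3

lemma integrableOn_rpow_mul_exp {c s : ℝ} (hc : 0 < c) (hs : -1 < s) :
    IntegrableOn (fun a : ℝ => a ^ s * Real.exp (-c * a)) (Set.Ioi 0) ∧
    ∫ a in Set.Ioi (0 : ℝ), a ^ s * Real.exp (-c * a) =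
      (1 / c) ^ (s + 1) * Real.Gamma (s + 1) := by
  have h := Real.integral_rpow_mul_exp_neg_mul_Ioi (a := s + 1) (by linarith) hc
  simp only [add_sub_cancel_right, ← neg_mul] at h
  refine ⟨?_, h⟩
  by_contra hn
  rw [integral_undef hn] at h
  have h1 : 0 < (1 / c) ^ (s + 1) := Real.rpow_pos_of_pos (by positivity) _
  have h2 : 0 < Real.Gamma (s + 1) := Real.Gamma_pos_of_pos (by linarith)
  exact (mul_pos h1 h2).ne h

/-- A generalization of Weber's exponential integral. -/
lemma integral_pow_mul_besselPhi {ν c : ℝ} (hν : -1 < ν) (hc : 0 < c) (α : ℂ) (m : ℕ) :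
    IntegrableOn (fun a : ℝ => ((a ^ ν * Real.exp (-c * a) : ℝ) : ℂ) * (a : ℂ) ^ m *
      besselPhi ν (α * a)) (Set.Ioi 0) ∧
    ∫ a in Set.Ioi (0 : ℝ), ((a ^ ν * Real.exp (-c * a) : ℝ) : ℂ) * (a : ℂ) ^ m *
      besselPhi ν (α * a) = (((1 / c) ^ (ν + 1) : ℝ) : ℂ) * Complex.exp (α / c) *
        (besselFactor ν m * PowerSeries.coeff m (laguerreSeries ν (1 / c) (α / c ^ 2))) := by
  have hc' : (c : ℂ) ≠ 0 := by exact_mod_cast hc.ne'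
  let F : ℕ → ℝ → ℂ := fun j a => α ^ j / (besselFactor ν j : ℂ) *
    ((a ^ (ν + (j + m : ℕ)) * Real.exp (-c * a) : ℝ) : ℂ)
  have hexp : ∀ j : ℕ, -1 < ν + ((j + m : ℕ) : ℝ) := fun j => by
    have : (0 : ℝ) ≤ ((j + m : ℕ) : ℝ) := Nat.cast_nonneg _
    linarith
  have hFi : ∀ j, Integrable (F j) (volume.restrict (Set.Ioi 0)) := fun j =>
    ((integrableOn_rpow_mul_exp hc (hexp j)).1.ofReal).const_mul _
  set K : ℂ := (((1 / c) ^ (ν + 1) : ℝ) : ℂ) * (1 / c) ^ m * besselFactor ν m with hK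
  have hFint : ∀ j, ∫ a in Set.Ioi (0 : ℝ), F j a = K * (PowerSeries.coeff j
      (PowerSeries.exp ℂ * PowerSeries.mk (kummerCoeff ν m)) * (α / c) ^ j) := by
    intro j
    simp only [F]
    rw [integral_const_mul, integral_complex_ofReal, (integrableOn_rpow_mul_exp hc (hexp j)).2,
      exp_mul_kummer hν, PowerSeries.coeff_mk, hK]
    have h1 : ν + ((j + m : ℕ) : ℝ) + 1 = (ν + 1) + ((j + m : ℕ) : ℝ) := by ring
    have h2 : ((j + m : ℕ) : ℝ) + ν + 1 = (ν + 1) + ((j + m : ℕ) : ℝ) := by ring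
    have h3 := besselFactor_ne_zero hν j
    have h4 := besselFactor_ne_zero hν m
    rw [h1, h2, Real.rpow_add_natCast (by positivity), pow_add]
    push_cast
    rw [div_pow α, one_div (c : ℂ), inv_pow _ j]
    field_simp
  -- only the factor `α ^ j` of `F j` is not positive
  have hFnorm : ∀ j, ∫ a in Set.Ioi (0 : ℝ), ‖F j a‖ = ‖∫ a in Set.Ioi (0 : ℝ), F j a‖ := by
    intro j
    have h1 : ∀ a ∈ Set.Ioi (0 : ℝ), ‖F j a‖ = ‖α ^ j / (besselFactor ν j : ℂ)‖ *
        (a ^ (ν + (j + m : ℕ)) * Real.exp (-c * a)) := by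
      intro a ha
      have ha' : 0 < a := ha
      simp only [F]
      rw [norm_mul, Complex.norm_real, Real.norm_of_nonneg (by positivity)]
    rw [setIntegral_congr_fun measurableSet_Ioi h1, integral_const_mul]
    simp only [F]
    rw [integral_const_mul, norm_mul, integral_complex_ofReal, Complex.norm_real,
      Real.norm_of_nonneg]
    refine setIntegral_nonneg measurableSet_Ioi fun a ha => ?_
    have ha' : 0 < a := ha
    positivity
  have hkum : (PowerSeries.mk (kummerCoeff ν m)).AbsSumsTo (α / c)
      (∑ l ∈ Finset.range (m + 1), kummerCoeff ν m l * (α / c) ^ l) := by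
    have hz : ∀ l, l ∉ Finset.range (m + 1) →
        PowerSeries.coeff l (PowerSeries.mk (kummerCoeff ν m)) * (α / c) ^ l = 0 := by
      intro l hl
      rw [PowerSeries.coeff_mk, kummerCoeff, if_neg, zero_mul]
      simpa [Nat.lt_succ_iff] using hl
    refine ⟨summable_of_ne_finset_zero (s := Finset.range (m + 1))
      fun l hl => by rw [hz l hl, norm_zero], ?_⟩
    simpa only [PowerSeries.coeff_mk] using hasSum_sum_of_ne_finset_zero hz
  have hone := absSumsTo_rescale_exp 1 (α / c)
  rw [PowerSeries.rescale_one, one_mul] at hone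
  have hprod := PowerSeries.AbsSumsTo.mul hone hkum
  have hsum : Summable fun j => ∫ a in Set.Ioi (0 : ℝ), ‖F j a‖ := by
    simp_rw [hFnorm, hFint, norm_mul K]
    exact hprod.1.mul_left _
  have hmeas : AEStronglyMeasurable (fun a : ℝ => ((a ^ ν * Real.exp (-c * a) : ℝ) : ℂ) *
      (a : ℂ) ^ m * besselPhi ν (α * a)) (volume.restrict (Set.Ioi 0)) := by
    have h1 : Measurable fun a : ℝ => ((a ^ ν * Real.exp (-c * a) : ℝ) : ℂ) * (a : ℂ) ^ m := by
      fun_prop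
    have h2 : Continuous fun a : ℝ => besselPhi ν (α * a) :=
      (besselPhi_differentiable hν).continuous.comp (by fun_prop)
    exact (h1.mul h2.measurable).aestronglyMeasurable
  obtain ⟨h1, h2⟩ := integrable_and_hasSum_integral hmeas hFi hsum (by
    rw [ae_restrict_iff' measurableSet_Ioi]
    refine Filter.Eventually.of_forall fun a ha => ?_
    have ha' : (0 : ℝ) < a := ha
    have h3 := ((summable_norm_besselPhi hν (α * a)).of_norm.hasSum).mul_left
      (((a ^ ν * Real.exp (-c * a) : ℝ) : ℂ) * (a : ℂ) ^ m)
    refine h3.congr_fun fun j => ?_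
    simp only [F]
    rw [Real.rpow_add_natCast ha'.ne', pow_add]
    push_cast
    ring)
  refine ⟨h1, ?_⟩
  simp_rw [hFint] at h2
  rw [h2.unique (hprod.2.mul_left K), hK]
  -- the polynomial that is left is a coefficient of `laguerreSeries`, up to rescaling
  have h5 : PowerSeries.coeff m (laguerreSeries ν (1 / c) (α / c ^ 2)) =
      (1 / c) ^ m * ∑ l ∈ Finset.range (m + 1), kummerCoeff ν m l * (α / c) ^ l := by
    rw [laguerreSeries, PowerSeries.coeff_mul, ← Finset.Nat.sum_antidiagonal_swap,
      Finset.Nat.sum_antidiagonal_eq_sum_range_succ_mk, Finset.mul_sum]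
    refine Finset.sum_congr rfl fun l hl => ?_
    have hl' : l ≤ m := by simpa [Nat.lt_succ_iff] using hl
    simp only [Prod.swap, PowerSeries.coeff_rescale, PowerSeries.coeff_exp, besselSeries,
      PowerSeries.coeff_mk, kummerCoeff, if_pos hl', eq_ratCast]
    have h6 : (1 / (c : ℂ)) ^ m = (1 / c) ^ (m - l) * (1 / c) ^ l := by
      rw [← pow_add, Nat.sub_add_cancel hl']
    rw [h6]
    have h7 := besselFactor_ne_zero hν l
    push_cast
    simp only [div_pow, one_pow]
    field_simp
    ring
  rw [h5]
  ring

/-! ### The transition density of the squared Bessel process -/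

/-- If `W` is the principal logarithm of `w / 2`, then `exp (W ν)` is the factor `(w / 2) ^ ν` that
separates the multivalued part of `I_ν(w)` from an even entire function. -/
lemma besselI_eq_of_exp (ν : ℝ) {w W : ℂ} (h1 : -π < W.im) (h2 : W.im ≤ π)
    (h : w / 2 = Complex.exp W) :
    besselI ν w = Complex.exp (W * ν) * besselPhi ν (w ^ 2 / 4) := by
  unfold besselI besselPhi
  rw [← tsum_mul_left]
  refine tsum_congr fun n => ?_
  have hw : w ^ 2 / 4 = Complex.exp W ^ 2 := by rw [← h]; ring
  have h3 : (w / 2) ^ ((2 * n + ν : ℝ) : ℂ) =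
      Complex.exp (W * ν) * (Complex.exp W ^ 2) ^ n := by
    rw [h, Complex.cpow_def_of_ne_zero (Complex.exp_ne_zero W), Complex.log_exp h1 h2, ← pow_mul,
      ← Complex.exp_nat_mul, ← Complex.exp_add]
    congr 1
    push_cast
    ring
  have h4 : Real.Gamma (n + 1) * Real.Gamma (n + 1 + ν) = besselFactor ν n := by
    rw [besselFactor, Real.Gamma_nat_eq_factorial]
    congr 2
    ring
  rw [h3, h4, hw]
  ring

/-- The branches of the principal powers in `besqP` made explicit by logarithms `L` and `W`. -/
lemma besqP_eq_of_log {ν t : ℝ} {x y L W : ℂ} (ht : t ≠ 0) (hx : x ≠ 0) (hy : y ≠ 0)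
    (hL : Complex.log (y / x) = L)
    (h1 : -π < W.im) (h2 : W.im ≤ π) (hW : (x * y) ^ (1 / 2 : ℂ) / t / 2 = Complex.exp W) :
    besqP ν t y x = 1 / (2 * |t| : ℝ) * Complex.exp (L * ν / 2 + W * ν) *
      Complex.exp (-(x + y) / (2 * t)) * besselPhi ν (x * y / (4 * t ^ 2)) := by
  have hsq : ((x * y) ^ (1 / 2 : ℂ) / t) ^ 2 / 4 = x * y / (4 * t ^ 2) := by
    have h3 : ((x * y) ^ (1 / 2 : ℂ)) ^ 2 = x * y := by simp
    rw [div_pow, h3]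
    have ht' : (t : ℂ) ≠ 0 := by exact_mod_cast ht
    field_simp
  unfold besqP
  rw [if_neg hx, besselI_eq_of_exp ν h1 h2 hW, hsq,
    Complex.cpow_def_of_ne_zero (div_ne_zero hy hx), hL, Complex.exp_add]
  have h4 : L * ((ν / 2 : ℝ) : ℂ) = L * ν / 2 := by push_cast; ring
  rw [h4]
  ring

/-- The entire function of `z` that agrees with `p^{(ν)}(t, y | z)`, `t > 0`, off the half-line
`z ≤ 0`. -/
noncomputable def besqEntire (ν t y : ℝ) (z : ℂ) : ℂ :=
  ((y ^ ν / (2 * t) ^ (ν + 1) : ℝ) : ℂ) * Complex.exp (-(z + y) / (2 * t)) *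
    besselPhi ν (y / (4 * t ^ 2) * z)

lemma besqEntire_differentiable {ν : ℝ} (hν : -1 < ν) (t y : ℝ) :
    Differentiable ℂ (besqEntire ν t y) := by
  unfold besqEntire
  have h : Differentiable ℂ fun z : ℂ => besselPhi ν (y / (4 * t ^ 2) * z) :=
    (besselPhi_differentiable hν).comp (by fun_prop)
  fun_prop

lemma exp_mul_log_eq_rpow {a : ℝ} (ha : 0 < a) (ν : ℝ) :
    Complex.exp ((Real.log a : ℝ) * ν) = ((a ^ ν : ℝ) : ℂ) := by
  rw [Real.rpow_def_of_pos ha]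
  push_cast
  rfl

/-- Off the cut, the branches of `(y / z) ^ (ν / 2)` and of `I_ν(√(z y) / t)` combine to an entire
function of `z`. -/
lemma besqP_eq_besqEntire {ν t y : ℝ} (ht : 0 < t) (hy : 0 ≤ y)
    (hyν : ν < 0 → 0 < y) {z : ℂ} (hz : z ∈ Complex.slitPlane) :
    besqP ν t y z = besqEntire ν t y z := by
  have hz0 : z ≠ 0 := Complex.slitPlane_ne_zero hz
  have ht' : (t : ℂ) ≠ 0 := by exact_mod_cast ht.ne'
  rcases hy.eq_or_lt with rfl | hy
  · have hν0 : 0 ≤ ν := not_lt.1 fun h => (hyν h).false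
    -- at `y = 0` both sides vanish unless `ν = 0`, because of the powers of zero
    have hI : besselI ν 0 = (if ν = 0 then 1 else 0) := by
      unfold besselI
      split_ifs with h
      · subst h
        rw [tsum_eq_single 0]
        · simp
        · intro n hn
          have : ((2 * n + 0 : ℝ) : ℂ) ≠ 0 := by
            have : (2 * n + 0 : ℝ) ≠ 0 := by
              have : (n : ℝ) ≠ 0 := by exact_mod_cast hn
              simpa using this
            exact_mod_cast this
          rw [zero_div, Complex.zero_cpow this, mul_zero]
      · have hall : ∀ n : ℕ, 1 / ((Real.Gamma (n + 1) * Real.Gamma (n + 1 + ν) : ℝ) : ℂ) *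
            (0 / 2 : ℂ) ^ ((2 * n + ν : ℝ) : ℂ) = 0 := by
          intro n
          have : ((2 * n + ν : ℝ) : ℂ) ≠ 0 := by
            have h1 : 0 < ν := lt_of_le_of_ne hν0 (Ne.symm h)
            have : (2 * n + ν : ℝ) ≠ 0 := by positivity
            exact_mod_cast this
          rw [zero_div, Complex.zero_cpow this, mul_zero]
        simp only [hall, tsum_zero]
    unfold besqP besqEntire
    rw [if_neg hz0]
    have h2 : (z * ((0 : ℝ) : ℂ)) ^ (1 / 2 : ℂ) / (t : ℂ) = 0 := by
      rw [Complex.ofReal_zero, mul_zero, Complex.zero_cpow (by norm_num), zero_div]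
    rw [h2, hI]
    by_cases h : ν = 0
    · subst h
      simp [besselPhi_zero, abs_of_pos ht]
    · simp [h, Real.zero_rpow h]
  · have hy0 : (y : ℂ) ≠ 0 := by exact_mod_cast hy.ne'
    have harg := (Complex.mem_slitPlane_iff_arg.1 hz).1
    have hlog : Complex.log (z * y) = Complex.log z + (Real.log y : ℝ) := by
      rw [mul_comm, Complex.log_ofReal_mul hy hz0, add_comm]
    have hL : Complex.log (y / z) = (Real.log y : ℝ) - Complex.log z := by
      rw [div_eq_mul_inv, Complex.log_ofReal_mul hy (inv_ne_zero hz0), Complex.log_inv _ harg,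
        sub_eq_add_neg]
    set W : ℂ := (Complex.log z + (Real.log y : ℝ)) / 2 - (Real.log (2 * t) : ℝ) with hW
    have him : W.im = z.arg / 2 := by
      rw [hW, Complex.sub_im, Complex.ofReal_im, sub_zero, Complex.div_ofNat_im, Complex.add_im,
        Complex.ofReal_im, add_zero, Complex.log_im]
    have hb1 := Complex.neg_pi_lt_arg z
    have hb2 := Complex.arg_le_pi z
    have hexp : (z * y) ^ (1 / 2 : ℂ) / t / 2 = Complex.exp W := by
      rw [Complex.cpow_def_of_ne_zero (mul_ne_zero hz0 hy0), hlog, hW, Complex.exp_sub,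
        ← Complex.ofReal_exp, Real.exp_log (by positivity)]
      push_cast
      rw [mul_one_div]
      field_simp
    rw [besqP_eq_of_log ht.ne' hz0 hy0 hL (by rw [him]; linarith [Real.pi_pos])
      (by rw [him]; linarith [Real.pi_pos]) hexp, besqEntire]
    have h3 : Complex.exp (((Real.log y : ℝ) - Complex.log z) * ν / 2 + W * ν) =
        ((y ^ ν / (2 * t) ^ ν : ℝ) : ℂ) := by
      rw [Complex.ofReal_div, ← exp_mul_log_eq_rpow hy, ← exp_mul_log_eq_rpow (by positivity),
        ← Complex.exp_sub]
      congr 1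
      rw [hW]
      ring
    have h4 : (y ^ ν / (2 * t) ^ (ν + 1) : ℝ) = 1 / (2 * |t|) * (y ^ ν / (2 * t) ^ ν) := by
      rw [Real.rpow_add_one (by positivity), abs_of_pos ht]
      field_simp
    rw [h3, h4]
    push_cast
    congr 2
    ring

/-- The phase that the principal power `s ^ ν`, `s < 0`, produces in `p^{(ν)}(-t, s | 0)`, in
contrast to `p^{(ν)}(-t, s | y)` for `y > 0`. -/
noncomputable def besqPhase (ν y : ℝ) : ℂ :=
  if y = 0 then Complex.exp (π * Complex.I * ν) else 1

lemma log_neg_ofReal {a : ℝ} (ha : 0 < a) :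
    Complex.log (-(a : ℂ)) = (Real.log a : ℝ) + π * Complex.I := by
  rw [← mul_neg_one, Complex.log_ofReal_mul ha (by norm_num), Complex.log_neg_one]

/-- The kernel at negative times, on the negative half-line: for `y > 0` the phases `exp (iπν / 2)`
of `(s / y) ^ (ν / 2)` and `exp (-iπν / 2)` of the Bessel function cancel. -/
lemma besqP_neg {ν t y a : ℝ} (ht : 0 < t) (hy : 0 ≤ y) (ha : 0 < a) :
    besqP ν (-t) ((-a : ℝ) : ℂ) y = besqPhase ν y * ((1 / (2 * t) ^ (ν + 1) : ℝ) : ℂ) *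
      Complex.exp (y / (2 * t)) * (((a ^ ν * Real.exp (-(1 / (2 * t)) * a) : ℝ) : ℂ) *
        besselPhi ν (-y / (4 * t ^ 2) * a)) := by
  have ht' : (t : ℂ) ≠ 0 := by exact_mod_cast ht.ne'
  have ha0 : (a : ℂ) ≠ 0 := by exact_mod_cast ha.ne'
  rcases hy.eq_or_lt with rfl | hy
  · have h1 : ((-a : ℝ) : ℂ) ^ (ν : ℂ) = Complex.exp (π * Complex.I * ν) * ((a ^ ν : ℝ) : ℂ) := by
      rw [Complex.cpow_def_of_ne_zero (by simpa using ha0), ← exp_mul_log_eq_rpow ha,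
        ← Complex.exp_add, Complex.ofReal_neg, log_neg_ofReal ha]
      congr 1
      ring
    have h2 : Complex.exp (-((-a : ℝ) : ℂ) / (2 * ((-t : ℝ) : ℂ))) =
        ((Real.exp (-(1 / (2 * t)) * a) : ℝ) : ℂ) := by
      rw [Complex.ofReal_exp]
      congr 1
      push_cast
      field_simp
    unfold besqP besqPhase
    rw [if_pos Complex.ofReal_zero, if_pos rfl, h1, h2, abs_neg, abs_of_pos ht]
    simp [besselPhi_zero]
    ring
  · have hy0 : (y : ℂ) ≠ 0 := by exact_mod_cast hy.ne'
    have hL : Complex.log (((-a : ℝ) : ℂ) / y) =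
        (Real.log a : ℝ) - (Real.log y : ℝ) + π * Complex.I := by
      have : ((-a : ℝ) : ℂ) / y = -((a / y : ℝ) : ℂ) := by push_cast; ring
      rw [this, log_neg_ofReal (by positivity), Real.log_div ha.ne' hy.ne']
      push_cast
      ring
    set W : ℂ := (((Real.log y + Real.log a) / 2 - Real.log (2 * t) : ℝ) : ℂ) +
      ((-(π / 2) : ℝ) : ℂ) * Complex.I with hW
    have him : W.im = -(π / 2) := by
      rw [hW, Complex.add_im, Complex.ofReal_im, Complex.im_ofReal_mul, Complex.I_im]
      ring
    have hexp : (y * ((-a : ℝ) : ℂ)) ^ (1 / 2 : ℂ) / ((-t : ℝ) : ℂ) / 2 = Complex.exp W := by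
      have h1 : (y : ℂ) * ((-a : ℝ) : ℂ) = -((y * a : ℝ) : ℂ) := by push_cast; ring
      have h2 : (((Real.log (y * a) : ℝ) : ℂ) + π * Complex.I) * (1 / 2 : ℂ) =
          (W + (Real.log (2 * t) : ℝ)) + π * Complex.I := by
        rw [hW, Real.log_mul hy.ne' ha.ne']
        push_cast
        ring
      rw [h1, Complex.cpow_def_of_ne_zero (neg_ne_zero.2 (by exact_mod_cast (mul_pos hy ha).ne')),
        log_neg_ofReal (mul_pos hy ha), h2, Complex.exp_add, Complex.exp_add, Complex.exp_pi_mul_I,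
        ← Complex.ofReal_exp, Real.exp_log (by positivity)]
      push_cast
      field_simp
    rw [besqP_eq_of_log (neg_ne_zero.2 ht.ne') hy0 (by simpa using ha0) hL
      (by rw [him]; linarith [Real.pi_pos]) (by rw [him]; linarith [Real.pi_pos]) hexp, besqPhase,
      if_neg hy.ne']
    have h3 : Complex.exp (((Real.log a : ℝ) - (Real.log y : ℝ) + π * Complex.I) * ν / 2 + W * ν) =
        ((a ^ ν / (2 * t) ^ ν : ℝ) : ℂ) := by
      rw [Complex.ofReal_div, ← exp_mul_log_eq_rpow ha, ← exp_mul_log_eq_rpow (by positivity),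
        ← Complex.exp_sub]
      congr 1
      rw [hW]
      push_cast
      ring
    have h4 : (1 / (2 * t) ^ (ν + 1) : ℝ) * a ^ ν = 1 / (2 * |-t|) * (a ^ ν / (2 * t) ^ ν) := by
      rw [Real.rpow_add_one (by positivity), abs_neg, abs_of_pos ht]
      field_simp
    have h5 : Complex.exp (-(y + ((-a : ℝ) : ℂ)) / (2 * ((-t : ℝ) : ℂ))) =
        Complex.exp (y / (2 * t)) * ((Real.exp (-(1 / (2 * t)) * a) : ℝ) : ℂ) := by
      rw [Complex.ofReal_exp, ← Complex.exp_add]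
      congr 1
      push_cast
      field_simp
    have h6 : (y : ℂ) * ((-a : ℝ) : ℂ) / (4 * ((-t : ℝ) : ℂ) ^ 2) = -y / (4 * t ^ 2) * a := by
      push_cast
      field_simp
    have h7 := congrArg (fun r : ℝ => (r : ℂ)) h4
    rw [h3, h5, h6]
    simp only [Complex.ofReal_mul, Complex.ofReal_div, Complex.ofReal_one] at h7 ⊢
    linear_combination (-Complex.exp (y / (2 * t)) * ((Real.exp (-(1 / (2 * t)) * a) : ℝ) : ℂ) *
      besselPhi ν (-y / (4 * t ^ 2) * a)) * h7

/-! ### The contour integrals and moments of the squared Bessel process -/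

/-- A contour around the origin meets the branch cut of the principal powers in one point only. -/
lemma contourAround_congr_slitPlane (ξ : Multiset ℝ) {f g : ℂ → ℂ}
    (h : ∀ z ∈ Complex.slitPlane, f z = g z) : contourAround ξ f = contourAround ξ g := by
  unfold contourAround
  congr 1
  have h0 : 0 ≤ (ξ.map fun a : ℝ => |a|).sum := Multiset.sum_nonneg (by simp)
  have hR : 0 < 1 + (ξ.map fun a : ℝ => |a|).sum := by linarith
  generalize 1 + (ξ.map fun a : ℝ => |a|).sum = R at hR
  unfold circleIntegral
  refine intervalIntegral.integral_congr_ae ?_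
  have hne : ∀ c : ℝ, ∀ᵐ θ : ℝ, θ ≠ c := fun c => Measure.ae_ne volume c
  filter_upwards [hne π, hne (2 * π)] with θ h1 h2 hθ
  rw [Set.uIoc_of_le (by positivity)] at hθ
  have him : (circleMap 0 R θ).im = R * Real.sin θ := by
    rw [circleMap_zero, Complex.im_ofReal_mul, Complex.exp_ofReal_mul_I_im]
  have hsin : Real.sin θ ≠ 0 := by
    rcases lt_or_gt_of_ne h1 with h3 | h3
    · exact (Real.sin_pos_of_pos_of_lt_pi hθ.1 h3).ne'
    · rw [← Real.sin_sub_two_pi]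
      have : θ < 2 * π := lt_of_le_of_ne hθ.2 h2
      exact (Real.sin_neg_of_neg_of_neg_pi_lt (by linarith) (by linarith)).ne
  rw [h _ (Complex.mem_slitPlane_iff.2 (Or.inr (by rw [him]; exact mul_ne_zero hR.ne' hsin)))]

lemma besqPhiPlus_eq {ν t y : ℝ} (ht : 0 < t) (hy : 0 ≤ y) (hyν : ν < 0 → 0 < y) (n : ℕ)
    (ξ : Multiset ℝ) : besqPhiPlus ν n t y ξ = contourAround (configTake ξ (n + 1))
      (fun s => besqEntire ν t y s * (1 / configProd (configTake ξ (n + 1)) s)) :=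
  contourAround_congr_slitPlane _ fun z hz => by rw [besqP_eq_besqEntire ht hy hyν hz]

lemma besqEntire_eq (ν t y : ℝ) (z : ℂ) : besqEntire ν t y z =
    ((y ^ ν / (2 * t) ^ (ν + 1) : ℝ) : ℂ) * Complex.exp (-y / (2 * t)) *
      (Complex.exp (-1 / (2 * t) * z) * besselPhi ν (y / (4 * t ^ 2) * z)) := by
  have h : Complex.exp (-(z + y) / (2 * t)) =
      Complex.exp (-y / (2 * t)) * Complex.exp (-1 / (2 * t) * z) := by
    rw [← Complex.exp_add]
    congr 1
    ring
  rw [besqEntire, h]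
  ring

lemma besqPhiPlus_configZero {ν t y : ℝ} (hν : -1 < ν) (ht : 0 < t) (hy : 0 ≤ y)
    (hyν : ν < 0 → 0 < y) {N n : ℕ} (hn : n < N) : besqPhiPlus ν n t y (configZero N) =
      ((y ^ ν / (2 * t) ^ (ν + 1) : ℝ) : ℂ) * Complex.exp (-y / (2 * t)) *
        PowerSeries.coeff n (laguerreSeries ν (-1 / (2 * t)) (y / (4 * t ^ 2))) := by
  rw [besqPhiPlus_eq ht hy hyν, configTake_configZero hn]
  refine contourAround_replicate_zero (besqEntire_differentiable hν t y)
    (c := fun n => ((y ^ ν / (2 * t) ^ (ν + 1) : ℝ) : ℂ) * Complex.exp (-y / (2 * t)) *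
        PowerSeries.coeff n (laguerreSeries ν (-1 / (2 * t)) (y / (4 * t ^ 2)))) (fun z => ?_) n
  rw [besqEntire_eq]
  simpa only [mul_assoc] using (absSumsTo_laguerreSeries hν (-1 / (2 * (t : ℂ)))
    (y / (4 * t ^ 2)) z).2.mul_left
      (((y ^ ν / (2 * t) ^ (ν + 1) : ℝ) : ℂ) * Complex.exp (-y / (2 * t)))

/-- The moments of `p^{(ν)}(-t, s | y)` on the negative axis: monomials evolved by the backward
equation of the squared Bessel process. -/
lemma besqP_neg_moment {ν t y : ℝ} (hν : -1 < ν) (ht : 0 < t) (hy : 0 ≤ y) (m : ℕ) :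
    IntegrableOn (fun s : ℝ => besqP ν (-t) s y * (s : ℂ) ^ m) (Set.Iic 0) ∧
    ∫ s in Set.Iic (0 : ℝ), besqP ν (-t) s y * (s : ℂ) ^ m =
      besqPhase ν y * (besselFactor ν m *
        PowerSeries.coeff m (laguerreSeries ν (-(2 * t)) y)) := by
  have ht' : (t : ℂ) ≠ 0 := by exact_mod_cast ht.ne'
  set K : ℂ := besqPhase ν y * ((1 / (2 * t) ^ (ν + 1) : ℝ) : ℂ) * Complex.exp (y / (2 * t)) with hK
  have h : ∀ a ∈ Set.Ioi (0 : ℝ), besqP ν (-t) ((-a : ℝ) : ℂ) y * ((-a : ℝ) : ℂ) ^ m =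
      (K * (-1) ^ m) * (((a ^ ν * Real.exp (-(1 / (2 * t)) * a) : ℝ) : ℂ) * (a : ℂ) ^ m *
        besselPhi ν (-y / (4 * t ^ 2) * a)) := by
    intro a ha
    rw [besqP_neg ht hy ha, hK, Complex.ofReal_neg, neg_pow (a : ℂ)]
    ring
  obtain ⟨h1, h2⟩ := integral_pow_mul_besselPhi hν (c := 1 / (2 * t)) (by positivity)
    (-y / (4 * t ^ 2)) m
  have h3 : IntegrableOn (fun a : ℝ => besqP ν (-t) ((-a : ℝ) : ℂ) y * ((-a : ℝ) : ℂ) ^ m)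
      (Set.Ioi 0) :=
    IntegrableOn.congr_fun (h1.const_mul (K * (-1) ^ m)) (fun a ha => (h a ha).symm)
      measurableSet_Ioi
  constructor
  · rw [integrableOn_Iic_iff_integrableOn_Iio]
    rw [← (Measure.measurePreserving_neg (volume : Measure ℝ)).integrableOn_comp_preimage
      (MeasurableEquiv.neg ℝ).measurableEmbedding]
    have h4 : Neg.neg ⁻¹' Set.Iio (0 : ℝ) = Set.Ioi 0 := by
      ext a
      simp
    rw [h4]
    exact h3
  · have h4 := integral_comp_neg_Ioi 0 (fun s : ℝ => besqP ν (-t) s y * (s : ℂ) ^ m)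
    rw [neg_zero] at h4
    rw [← h4, setIntegral_congr_fun measurableSet_Ioi h, integral_const_mul, h2]
    have h5 : (-y / (4 * t ^ 2) : ℂ) / ((1 / (2 * t) : ℝ) : ℂ) = -(y / (2 * t)) := by
      push_cast
      field_simp
      ring
    have h6 : 1 / ((1 / (2 * t) : ℝ) : ℂ) = 2 * t := by
      push_cast
      field_simp
    have h7 : (-y / (4 * t ^ 2) : ℂ) / ((1 / (2 * t) : ℝ) : ℂ) ^ 2 = -y := by
      push_cast
      field_simp
      ring
    have h8 : (-1) ^ m * PowerSeries.coeff m (laguerreSeries ν (2 * t) (-y)) =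
        PowerSeries.coeff m (laguerreSeries ν (-(2 * t)) y) := by
      rw [← PowerSeries.coeff_rescale, rescale_laguerreSeries]
      congr 2 <;> ring
    have h9 : ((1 / (2 * t) ^ (ν + 1) : ℝ) : ℂ) * (((1 / (1 / (2 * t))) ^ (ν + 1) : ℝ) : ℂ) = 1 := by
      have : (2 * t) ^ (ν + 1) ≠ 0 := (Real.rpow_pos_of_pos (by positivity) _).ne'
      rw [one_div_one_div]
      norm_cast
      field_simp
    have h10 := Complex.exp_ne_zero (y / (2 * t))
    rw [h5, h6, h7, ← h8, hK, Complex.exp_neg]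
    have h11 : Complex.exp (y / (2 * t)) * (Complex.exp (y / (2 * t)))⁻¹ = 1 := mul_inv_cancel₀ h10
    linear_combination (besqPhase ν y * (-1) ^ m * besselFactor ν m *
      PowerSeries.coeff m (laguerreSeries ν (2 * t) (-y))) * h9 +
      (besqPhase ν y * (-1) ^ m * besselFactor ν m *
      PowerSeries.coeff m (laguerreSeries ν (2 * t) (-y)) * ((1 / (2 * t) ^ (ν + 1) : ℝ) : ℂ) *
        (((1 / (1 / (2 * t))) ^ (ν + 1) : ℝ) : ℂ)) * h11

lemma besqPhiMinus_eq {ν t y : ℝ} (hν : -1 < ν) (ht : 0 < t) (hy : 0 ≤ y) (ξ : Multiset ℝ)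
    (n : ℕ) : besqPhiMinus ν n t y ξ = (newtonPoly ξ n).sum fun m c =>
      c * (besqPhase ν y * (besselFactor ν m *
        PowerSeries.coeff m (laguerreSeries ν (-(2 * t)) y))) :=
  integral_mul_configProd (fun m => (besqP_neg_moment hν ht hy m).1)
    (fun m => (besqP_neg_moment hν ht hy m).2) ξ n

/-- The one-particle weight `a ^ ν exp (-a / 2v)`, `a ≥ 0`, of the chiral GUE. -/
noncomputable def laguerreWeight (ν v : ℝ) : ℝ → ℂ :=
  (Set.Ici (0 : ℝ)).indicator fun a => ((a ^ ν * Real.exp (-a / (2 * v)) : ℝ) : ℂ)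

lemma mul_laguerreWeight (ν v : ℝ) (h : ℝ → ℂ) (k : ℕ) :
    (fun a : ℝ => h a * ((a : ℂ) ^ k * laguerreWeight ν v a)) = (Set.Ici (0 : ℝ)).indicator
      fun a => h a * ((a : ℂ) ^ k * ((a ^ ν * Real.exp (-a / (2 * v)) : ℝ) : ℂ)) := by
  funext a
  by_cases ha : a ∈ Set.Ici (0 : ℝ) <;> simp [laguerreWeight, ha]

/-- The transition density integrated against `a ^ k` times the Laguerre weight. -/
lemma integral_besqEntire_mul_pow {ν t v : ℝ} (hν : -1 < ν) (ht : 0 < t) (hv : 0 < v) (y : ℝ)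
    (k : ℕ) :
    Integrable (fun a : ℝ => besqEntire ν t y a * ((a : ℂ) ^ k * laguerreWeight ν v a)) ∧
    ∫ a : ℝ, besqEntire ν t y a * ((a : ℂ) ^ k * laguerreWeight ν v a) =
      (((2 * v) ^ (ν + 1) : ℝ) : ℂ) * (((y ^ ν / (2 * (t + v)) ^ (ν + 1) : ℝ) : ℂ) *
        Complex.exp (-y / (2 * (t + v)))) * (besselFactor ν k * PowerSeries.coeff k
          (laguerreSeries ν (2 * (t * v) / (t + v)) (y * v ^ 2 / (t + v) ^ 2))) := by
  have ht' : (t : ℂ) ≠ 0 := by exact_mod_cast ht.ne'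
  have hv' : (v : ℂ) ≠ 0 := by exact_mod_cast hv.ne'
  have htv : (t + v : ℂ) ≠ 0 := by exact_mod_cast (add_pos ht hv).ne'
  have hc : 0 < 1 / (2 * t) + 1 / (2 * v) := by positivity
  set K : ℂ := ((y ^ ν / (2 * t) ^ (ν + 1) : ℝ) : ℂ) * Complex.exp (-y / (2 * t)) with hK
  have h : ∀ a : ℝ, besqEntire ν t y a *
      ((a : ℂ) ^ k * ((a ^ ν * Real.exp (-a / (2 * v)) : ℝ) : ℂ)) =
      K * (((a ^ ν * Real.exp (-(1 / (2 * t) + 1 / (2 * v)) * a) : ℝ) : ℂ) * (a : ℂ) ^ k *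
        besselPhi ν (y / (4 * t ^ 2) * a)) := by
    intro a
    have h1 : Real.exp (-(1 / (2 * t) + 1 / (2 * v)) * a) =
        Real.exp (-1 / (2 * t) * a) * Real.exp (-a / (2 * v)) := by
      rw [← Real.exp_add]
      congr 1
      ring
    rw [h1, besqEntire_eq, hK]
    push_cast
    ring
  obtain ⟨h1, h2⟩ := integral_pow_mul_besselPhi hν hc (y / (4 * t ^ 2)) k
  rw [mul_laguerreWeight, integrable_indicator_iff measurableSet_Ici,
    integral_indicator measurableSet_Ici, integral_Ici_eq_integral_Ioi,
    integrableOn_Ici_iff_integrableOn_Ioi]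
  simp_rw [h]
  refine ⟨h1.const_mul K, ?_⟩
  rw [integral_const_mul, h2]
  have hcc : ((1 / (2 * t) + 1 / (2 * v) : ℝ) : ℂ) = (t + v) / (2 * t * v) := by
    push_cast
    field_simp
    ring
  have h3 : 1 / ((1 / (2 * t) + 1 / (2 * v) : ℝ) : ℂ) = 2 * (t * v) / (t + v) := by
    rw [hcc]
    field_simp
  have h4 : (y / (4 * t ^ 2) : ℂ) / ((1 / (2 * t) + 1 / (2 * v) : ℝ) : ℂ) ^ 2 =
      y * v ^ 2 / (t + v) ^ 2 := by
    rw [hcc]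
    field_simp
    ring
  have h5 : Complex.exp (-y / (2 * t)) *
      Complex.exp ((y / (4 * t ^ 2) : ℂ) / ((1 / (2 * t) + 1 / (2 * v) : ℝ) : ℂ)) =
      Complex.exp (-y / (2 * (t + v))) := by
    rw [hcc, ← Complex.exp_add]
    congr 1
    field_simp
    ring
  have h6 : ((y ^ ν / (2 * t) ^ (ν + 1) : ℝ) : ℂ) *
      (((1 / (1 / (2 * t) + 1 / (2 * v))) ^ (ν + 1) : ℝ) : ℂ) =
      (((2 * v) ^ (ν + 1) : ℝ) : ℂ) * ((y ^ ν / (2 * (t + v)) ^ (ν + 1) : ℝ) : ℂ) := by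
    have e1 : 1 / (1 / (2 * t) + 1 / (2 * v)) = 2 * t * (2 * v) / (2 * (t + v)) := by
      field_simp
      ring
    rw [e1, Real.div_rpow (by positivity) (by positivity),
      Real.mul_rpow (by positivity : 0 ≤ 2 * t) (by positivity)]
    have h7 : (2 * t) ^ (ν + 1) ≠ 0 := (Real.rpow_pos_of_pos (by positivity) _).ne'
    rw [← Complex.ofReal_mul, ← Complex.ofReal_mul]
    congr 1
    generalize (2 * t) ^ (ν + 1) = A at h7 ⊢
    field_simp
  rw [h3, h4, hK, ← h5]
  linear_combination (Complex.exp (-y / (2 * t)) *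
      Complex.exp ((y / (4 * t ^ 2) : ℂ) / ((1 / (2 * t) + 1 / (2 * v) : ℝ) : ℂ)) *
      (besselFactor ν k * PowerSeries.coeff k
          (laguerreSeries ν (2 * (t * v) / (t + v)) (y * v ^ 2 / (t + v) ^ 2)))) * h6

/-! ### Averaging over the chiral GUE -/

/-- The normalizing constant of the chiral GUE. -/
lemma prod_besselFactor {ν σ : ℝ} (hσ : 0 < σ) (N : ℕ) :
    ∏ k ∈ Finset.range N, (besselFactor ν k * (2 * σ ^ 2) ^ (ν + 1) * (4 * (σ ^ 2) ^ 2) ^ k) =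
      σ ^ (2 * N * (N + ν)) * (2 ^ (N * (N + ν)) *
        ∏ j ∈ Finset.Icc 1 N, (Real.Gamma j * Real.Gamma (j + ν))) := by
  induction N with
  | zero => simp
  | succ N ih =>
    rw [Finset.prod_range_succ, ih, Finset.prod_Icc_succ_top (by omega)]
    have h1 : Real.Gamma ((N + 1 : ℕ) : ℝ) = N.factorial := by
      push_cast
      exact Real.Gamma_nat_eq_factorial N
    have h0 : ((N + 1 : ℕ) : ℝ) + ν = N + ν + 1 := by push_cast; ring
    have e : ∀ x : ℝ, 0 < x → x ^ (((N + 1 : ℕ) : ℝ) * (N + ν + 1)) =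
        x ^ (N * (N + ν)) * (x ^ (ν + 1) * (x ^ 2) ^ N) := by
      intro x hx
      rw [← pow_mul, ← Real.rpow_natCast x, ← Real.rpow_add hx, ← Real.rpow_add hx]
      congr 1
      push_cast
      ring
    have h2 : ∀ y : ℝ, σ ^ (2 * y) = (σ ^ 2) ^ y := fun y => by
      rw [Real.rpow_mul hσ.le, Real.rpow_two]
    have h3 : σ ^ (2 * ((N + 1 : ℕ) : ℝ) * (((N + 1 : ℕ) : ℝ) + ν)) =
        (σ ^ 2) ^ (N * (N + ν)) * ((σ ^ 2) ^ (ν + 1) * ((σ ^ 2) ^ 2) ^ N) := by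
      rw [h0, mul_assoc, h2, e _ (by positivity)]
    have h4 : (2 : ℝ) ^ (((N + 1 : ℕ) : ℝ) * (((N + 1 : ℕ) : ℝ) + ν)) =
        2 ^ (N * (N + ν)) * (2 ^ (ν + 1) * 4 ^ N) := by
      rw [h0, e 2 (by norm_num)]
      norm_num
    rw [h3, h4, h1, h0, mul_assoc 2 (N : ℝ), h2, besselFactor,
      Real.mul_rpow (by norm_num) (by positivity), mul_pow]
    ring

/-- The invariance of the determinants under randomization of the initial configuration, for the
noncolliding squared Bessel process observed at finitely many space-time points. -/
theorem chgueExpect_det_besqKernel (N : ℕ) {ν σ : ℝ} (hν : -1 < ν) (hσ : 0 < σ) {ι : Type*}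
    [Fintype ι] [DecidableEq ι] (t x : ι → ℝ) (ht : ∀ p, 0 < t p) (hx : ∀ p, 0 ≤ x p)
    (hxν : ν < 0 → ∀ p, 0 < x p) :
    ChgueIntegrable N ν σ
      (fun ξ => (Matrix.of fun p q => besqKernel ν ξ (t p) (x p) (t q) (x q)).det) ∧
    chgueExpect N ν σ
      (fun ξ => (Matrix.of fun p q => besqKernel ν ξ (t p) (x p) (t q) (x q)).det) =
      (Matrix.of fun p q =>
        besqKernel ν (configZero N) (t p + σ ^ 2) (x p) (t q + σ ^ 2) (x q)).det := by
  have hv : 0 < σ ^ 2 := by positivity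
  have ht2 : ∀ p, 0 < t p + σ ^ 2 := fun p => add_pos (ht p) hv
  have hxν' : ∀ p, ν < 0 → 0 < x p := fun p h => hxν h p
  set v : ℂ := ((σ ^ 2 : ℝ) : ℂ) with hvdef
  let w : ℝ → ℂ := laguerreWeight ν (σ ^ 2)
  let Z : ℂ := ((σ ^ (-(2 * N * (N + ν))) / (2 ^ (N * (N + ν)) *
    ∏ j ∈ Finset.Icc 1 N, (Real.Gamma j * Real.Gamma (j + ν))) : ℝ) : ℂ)
  let κ : ℂ := (((2 * σ ^ 2) ^ (ν + 1) : ℝ) : ℂ)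
  let e : ℕ → ℂ := fun n => PowerSeries.coeff n (PowerSeries.rescale (2 * v) (PowerSeries.exp ℂ))
  have he : ∀ n, e n = (2 * v) ^ n / n.factorial := fun n => by
    simp only [e, PowerSeries.coeff_rescale, PowerSeries.coeff_exp, eq_ratCast]
    push_cast
    ring
  let b : ι → ℕ → ℂ := fun q m => besqPhase ν (x q) * (besselFactor ν m *
        PowerSeries.coeff m (laguerreSeries ν (-(2 * t q)) (x q)))
  let P : ι → ι → ℂ := fun p q => if t q < t p then besqP ν (t p - t q) (x p) (x q) else 0
  let C : Matrix ι (Fin N) ℂ := Matrix.of fun p n =>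
    ((x p ^ ν / (2 * (t p + σ ^ 2)) ^ (ν + 1) : ℝ) : ℂ) *
      Complex.exp (-x p / (2 * ((t p + σ ^ 2 : ℝ) : ℂ))) *
        PowerSeries.coeff n (laguerreSeries ν (-1 / (2 * ((t p + σ ^ 2 : ℝ) : ℂ)))
          (x p / (4 * ((t p + σ ^ 2 : ℝ) : ℂ) ^ 2)))
  let B : Matrix (Fin N) ι ℂ := Matrix.of fun m q => besqPhase ν (x q) * (besselFactor ν m *
        PowerSeries.coeff m (laguerreSeries ν (-(2 * ((t q + σ ^ 2 : ℝ) : ℂ))) (x q)))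
  let D : Matrix (Fin N) (Fin N) ℂ := Matrix.of fun m n => if (n : ℕ) ≤ m then
    besselFactor ν m / besselFactor ν n * e (m - n) else 0
  let T : Matrix (Fin N) (Fin N) ℂ := Matrix.of fun n k => if (n : ℕ) ≤ k then
    besselFactor ν k * κ * (4 * v ^ 2) ^ (n : ℕ) * e (k - n) else 0
  have hmom : ∀ n : ℕ, Integrable (fun a : ℝ => (a : ℂ) ^ n * w a) ∧
      ∫ a : ℝ, (a : ℂ) ^ n * w a =
        (((2 * σ ^ 2) ^ (ν + n + 1) * Real.Gamma (ν + n + 1) : ℝ) : ℂ) := by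
    intro n
    have hn : -1 < ν + (n : ℝ) := by linarith [(Nat.cast_nonneg n : (0 : ℝ) ≤ n)]
    obtain ⟨h1, h2⟩ := integrableOn_rpow_mul_exp (c := 1 / (2 * σ ^ 2)) (by positivity) hn
    have h3 : Set.EqOn (fun a : ℝ => ((a ^ (ν + n) * Real.exp (-(1 / (2 * σ ^ 2)) * a) : ℝ) : ℂ))
        (fun a : ℝ => (1 : ℂ) * ((a : ℂ) ^ n * ((a ^ ν * Real.exp (-a / (2 * σ ^ 2)) : ℝ) : ℂ)))
        (Set.Ioi 0) := by
      intro a ha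
      have h4 : -(1 / (2 * σ ^ 2)) * a = -a / (2 * σ ^ 2) := by ring
      simp only [Real.rpow_add_natCast (ne_of_gt ha), h4]
      push_cast
      ring
    have h5 := mul_laguerreWeight ν (σ ^ 2) (fun _ => 1) n
    simp only [one_mul] at h3 h5
    simp only [w]
    rw [h5, integrable_indicator_iff measurableSet_Ici, integral_indicator measurableSet_Ici,
      integral_Ici_eq_integral_Ioi, integrableOn_Ici_iff_integrableOn_Ioi,
      ← setIntegral_congr_fun measurableSet_Ioi h3, integral_complex_ofReal, h2, one_div_one_div]
    exact ⟨IntegrableOn.congr_fun h1.ofReal h3 measurableSet_Ioi, rfl⟩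
  have hmain := expect_det (N := N) w Z (fun p => besqEntire ν (t p) (x p))
    (fun p => besqEntire_differentiable hν _ _) b P ?_
    (fun p k => (integral_besqEntire_mul_pow hν (ht p) hv _ k).1)
    D T C B ?_ ?_ ?_ ?_ (fun ξ p q => besqKernel ν ξ (t p) (x p) (t q) (x q)) ?_
  · have hRHS : (Matrix.of fun p q =>
        besqKernel ν (configZero N) (t p + σ ^ 2) (x p) (t q + σ ^ 2) (x q)) =
          C * B - Matrix.of P := by
      ext p q
      rw [Matrix.sub_apply, Matrix.mul_apply, Matrix.of_apply, besqKernel, card_configZero,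
        Finset.sum_range]
      congr 1
      · refine Finset.sum_congr rfl fun n _ => ?_
        rw [besqPhiPlus_configZero hν (ht2 p) (hx p) (hxν' p) n.2,
          besqPhiMinus_eq hν (ht2 q) (hx q), newtonPoly_configZero n.2.le,
          ← Polynomial.monomial_one_right_eq_X_pow,
          Polynomial.sum_monomial_index _ _ (by simp), one_mul]
        rfl
      · simp [P]
    have hset : chamberPlus N = chamberA N ∩ {a | ∀ j, 0 ≤ a j} := Set.inter_comm _ _
    have hmeas : MeasurableSet {a : Fin N → ℝ | ∀ j, 0 ≤ a j} := by
      rw [Set.ofPred_forall]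
      exact MeasurableSet.iInter fun j => measurableSet_le measurable_const (measurable_pi_apply j)
    -- the weight vanishes on the negative half-line, so the smaller chamber may be enlarged
    have hdens : ∀ F : (Fin N → ℝ) → ℂ, {a : Fin N → ℝ | ∀ j, 0 ≤ a j}.indicator
        (fun a => F a * (chgueDensity N ν σ a : ℂ)) =
          fun a => F a * (Z * (∏ k, w (a k)) * (hProd a : ℂ) ^ 2) := by
      intro F
      funext a
      by_cases ha : ∀ j, 0 ≤ a j
      · have h1 : ∀ j, w (a j) = ((a j ^ ν * Real.exp (-a j / (2 * σ ^ 2)) : ℝ) : ℂ) := fun j =>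
          Set.indicator_of_mem (Set.mem_Ici.2 (ha j)) _
        rw [Set.indicator_of_mem (by exact ha)]
        simp only [h1, chgueDensity, Z]
        push_cast
        rfl
      · rw [Set.indicator_of_notMem (by exact ha)]
        obtain ⟨j, hj⟩ := not_forall.1 ha
        have h1 : w (a j) = 0 := Set.indicator_of_notMem (by simpa using hj) _
        rw [Finset.prod_eq_zero (Finset.mem_univ j) h1]
        simp
    unfold ChgueIntegrable chgueExpect
    rw [hRHS, hset, ← setIntegral_indicator hmeas, Set.inter_comm, IntegrableOn,
      ← Measure.restrict_restrict hmeas, ← IntegrableOn, ← integrable_indicator_iff hmeas, hdens]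
    exact hmain
  · exact fun k => (hmom k).1
  · intro m k
    have h1 : ((2 * σ ^ 2) ^ (ν + (m + k : ℕ) + 1) : ℝ) =
        (2 * σ ^ 2) ^ (ν + 1) * (2 * σ ^ 2) ^ ((m : ℕ) + k) := by
      rw [add_right_comm, Real.rpow_add_natCast (by positivity)]
    have h2 : ν + ((m + k : ℕ) : ℝ) + 1 = ((k + m : ℕ) : ℝ) + ν + 1 := by push_cast; ring
    have h3 := congrArg (PowerSeries.coeff (k : ℕ)) (exp_mul_kummer hν m)
    have hm0 := besselFactor_ne_zero hν (m : ℕ)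
    have hk0 := besselFactor_ne_zero hν (k : ℕ)
    rw [PowerSeries.coeff_mk, eq_div_iff (mul_ne_zero hk0 hm0), PowerSeries.coeff_mul,
      ← sum_fin_toeplitz k.2 (fun i => PowerSeries.coeff i (PowerSeries.exp ℂ))
        fun n => PowerSeries.coeff n (PowerSeries.mk (kummerCoeff ν m))] at h3
    rw [(hmom _).2, h1, h2, Complex.ofReal_mul, ← h3, Matrix.mul_apply, Finset.sum_mul,
      Finset.mul_sum]
    refine Finset.sum_congr rfl fun n _ => ?_
    simp only [D, T, Matrix.of_apply, PowerSeries.coeff_mk, kummerCoeff]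
    by_cases hm : (n : ℕ) ≤ m
    · by_cases hk : (n : ℕ) ≤ k
      · simp only [hm, hk, if_true, κ, he, PowerSeries.coeff_exp]
        obtain ⟨c, hc⟩ := Nat.exists_eq_add_of_le hm
        obtain ⟨d, hd⟩ := Nat.exists_eq_add_of_le hk
        have h4 : (m : ℕ) + k = c + d + 2 * n := by omega
        have h5 : (m : ℕ) - n = c := by omega
        have h6 : (k : ℕ) - n = d := by omega
        have h7 : (4 * v ^ 2) = (2 * v) ^ 2 := by ring
        rw [h4, h5, h6, h7, ← pow_mul, eq_ratCast, pow_add, pow_add, hvdef]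
        push_cast
        ring
      · simp [hk]
    · simp [hm]
  · intro p k
    have htp : (t p : ℂ) + v ≠ 0 := by
      rw [hvdef]
      exact_mod_cast (ht2 p).ne'
    have h1 := (integral_besqEntire_mul_pow hν (ht p) hv (x p) k).2
    have h2 : laguerreSeries ν (2 * (t p * v) / (t p + v)) (x p * v ^ 2 / (t p + v) ^ 2) =
        PowerSeries.rescale (2 * v) (PowerSeries.exp ℂ) * PowerSeries.rescale (4 * v ^ 2)
          (laguerreSeries ν (-1 / (2 * ((t p + σ ^ 2 : ℝ) : ℂ)))
            (x p / (4 * ((t p + σ ^ 2 : ℝ) : ℂ) ^ 2))) := by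
      rw [rescale_laguerreSeries, ← laguerreSeries_add, Complex.ofReal_add, ← hvdef]
      congr 1
      · field_simp
        ring
      · field_simp
    rw [h1, ← hvdef, h2, PowerSeries.coeff_mul, Matrix.mul_apply]
    simp only [PowerSeries.coeff_rescale _ (4 * v ^ 2)]
    rw [← sum_fin_toeplitz k.2 e fun n => (4 * v ^ 2) ^ n * PowerSeries.coeff n
      (laguerreSeries ν (-1 / (2 * ((t p + σ ^ 2 : ℝ) : ℂ)))
        (x p / (4 * ((t p + σ ^ 2 : ℝ) : ℂ) ^ 2))), Finset.mul_sum, Finset.mul_sum]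
    refine Finset.sum_congr rfl fun n _ => ?_
    simp only [C, T, Matrix.of_apply, κ, Complex.ofReal_add, ← hvdef]
    split_ifs
    · ring
    · simp
  · intro m q
    have h1 : (-(2 * t q : ℂ)) = 2 * v + -(2 * ((t q + σ ^ 2 : ℝ) : ℂ)) := by
      rw [hvdef]
      push_cast
      ring
    simp only [b]
    rw [h1, laguerreSeries_add, PowerSeries.coeff_mul, Matrix.mul_apply]
    rw [← sum_fin_toeplitz m.2 e fun n => PowerSeries.coeff n
      (laguerreSeries ν (-(2 * ((t q + σ ^ 2 : ℝ) : ℂ))) (x q)), Finset.mul_sum, Finset.mul_sum]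
    refine Finset.sum_congr rfl fun n _ => ?_
    have h2 := besselFactor_ne_zero hν (n : ℕ)
    simp only [D, B, Matrix.of_apply]
    split_ifs
    · field_simp
    · simp
  · have hD : D.det = 1 := by
      rw [det_lower_of_ite fun m n => (besselFactor ν m / besselFactor ν n * e (m - n) : ℂ)]
      refine Finset.prod_eq_one fun n _ => ?_
      have h2 := besselFactor_ne_zero hν (n : ℕ)
      simp [he, h2]
    have hT : T.det = ((∏ k ∈ Finset.range N,
        (besselFactor ν k * (2 * σ ^ 2) ^ (ν + 1) * (4 * (σ ^ 2) ^ 2) ^ k) : ℝ) : ℂ) := by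
      rw [det_upper_of_ite fun n k => (besselFactor ν k * κ * (4 * v ^ 2) ^ n * e (k - n) : ℂ),
        Finset.prod_range]
      simp [he, κ, v]
    rw [hD, hT, one_mul, prod_besselFactor hσ]
    simp only [Z]
    have h1 : ∏ j ∈ Finset.Icc 1 N, (Real.Gamma j * Real.Gamma (j + ν)) ≠ 0 := by
      refine Finset.prod_ne_zero_iff.2 fun j hj => ?_
      have h2 : (1 : ℝ) ≤ j := by exact_mod_cast (Finset.mem_Icc.1 hj).1
      exact (mul_pos (Real.Gamma_pos_of_pos (by linarith))
        (Real.Gamma_pos_of_pos (by linarith))).ne'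
    have h2 : (2 : ℝ) ^ (N * (N + ν)) ≠ 0 := (Real.rpow_pos_of_pos (by positivity) _).ne'
    have h3 : σ ^ (2 * N * (N + ν)) ≠ 0 := (Real.rpow_pos_of_pos hσ _).ne'
    rw [Real.rpow_neg hσ.le, ← Complex.ofReal_mul, ← Complex.ofReal_one]
    congr 1
    field_simp
  · intro ξ p q
    rw [besqKernel]
    congr 1
    · refine Finset.sum_congr rfl fun n _ => ?_
      rw [besqPhiMinus_eq hν (ht q) (hx q), besqPhiPlus_eq (ht p) (hx p) (hxν' p)]

/-! ### Multitime determinants of the two processes -/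

theorem corollary1 (N : ℕ) (hN : 1 ≤ N) (σ : ℝ) (hσ : 0 < σ) :
    -- noncolliding Brownian motion, several times
    (∀ (M : ℕ) (_ : 1 ≤ M) (t : Fin M → ℝ) (_ : ∀ m, 0 < t m) (_ : StrictMono t)
      (L : Fin M → ℕ) (_ : ∀ m, 1 ≤ L m ∧ L m ≤ N) (x : (m : Fin M) → Fin (L m) → ℝ),
      GueIntegrable N σ (fun ξ => multitimeDet L (bmKernel ξ) t x) ∧
      gueExpect N σ (fun ξ => multitimeDet L (bmKernel ξ) t x) =
        multitimeDet L (bmKernel (configZero N)) (fun m => t m + σ ^ 2) x) ∧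
    -- noncolliding squared Bessel process, several times
    (∀ (ν : ℝ) (_ : -1 < ν)
      (M : ℕ) (_ : 1 ≤ M) (t : Fin M → ℝ) (_ : ∀ m, 0 < t m) (_ : StrictMono t)
      (L : Fin M → ℕ) (_ : ∀ m, 1 ≤ L m ∧ L m ≤ N) (x : (m : Fin M) → Fin (L m) → ℝ)
      (_ : ∀ m j, 0 ≤ x m j) (_ : ν < 0 → ∀ m j, 0 < x m j),
      ChgueIntegrable N ν σ (fun ξ => multitimeDet L (besqKernel ν ξ) t x) ∧
      chgueExpect N ν σ (fun ξ => multitimeDet L (besqKernel ν ξ) t x) =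
        multitimeDet L (besqKernel ν (configZero N)) (fun m => t m + σ ^ 2) x) ∧
    -- noncolliding Brownian motion, a single time
    (∀ (L : ℕ) (_ : 1 ≤ L) (_ : L ≤ N) (t : ℝ) (_ : 0 < t) (x : Fin L → ℝ),
      GueIntegrable N σ
        (fun ξ => (Matrix.of fun j k => bmKernel ξ t (x j) t (x k)).det) ∧
      gueExpect N σ
        (fun ξ => (Matrix.of fun j k => bmKernel ξ t (x j) t (x k)).det) =
        (Matrix.of fun j k =>
          bmKernel (configZero N) (t + σ ^ 2) (x j) (t + σ ^ 2) (x k)).det) ∧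
    -- noncolliding squared Bessel process, a single time
    (∀ (ν : ℝ) (_ : -1 < ν) (L : ℕ) (_ : 1 ≤ L) (_ : L ≤ N) (t : ℝ) (_ : 0 < t)
      (x : Fin L → ℝ) (_ : ∀ j, 0 ≤ x j) (_ : ν < 0 → ∀ j, 0 < x j),
      ChgueIntegrable N ν σ
        (fun ξ => (Matrix.of fun j k => besqKernel ν ξ t (x j) t (x k)).det) ∧
      chgueExpect N ν σ
        (fun ξ => (Matrix.of fun j k => besqKernel ν ξ t (x j) t (x k)).det) =
        (Matrix.of fun j k =>
          besqKernel ν (configZero N) (t + σ ^ 2) (x j) (t + σ ^ 2) (x k)).det) := by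
  refine ⟨?_, ?_, ?_, ?_⟩
  · intro M _ t ht _ L _ x
    exact gueExpect_det_bmKernel N hσ (fun p : (m : Fin M) × Fin (L m) => t p.1)
      (fun p => x p.1 p.2) fun p => ht p.1
  · intro ν hν M _ t ht _ L _ x hx hx'
    exact chgueExpect_det_besqKernel N hν hσ (fun p : (m : Fin M) × Fin (L m) => t p.1)
      (fun p => x p.1 p.2) (fun p => ht p.1) (fun p => hx p.1 p.2) fun h p => hx' h p.1 p.2
  · intro L _ _ t ht x
    exact gueExpect_det_bmKernel N hσ (fun _ => t) x fun _ => ht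
  · intro ν hν L _ _ t ht x hx hx'
    exact chgueExpect_det_besqKernel N hν hσ (fun _ => t) x (fun _ => ht) hx hx'
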